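/- For real $x\ge 1$ let $$N_{2,3,5,7}(x)=\#\{(p,q,l,f)\in\mathbb{N}_0^4 : 2^p3^q5^l7^f\le x\},$$ let $S_{2,3,5,7}=\{2^p3^q5^l7^f : p,q,l,f\in\mathbb{N}_0\}$ and let $\chi_{S_{2,3,5,7}}$ be its characteristic function. Let $B_1^*(\{t\})=\{t\}-\frac12$ if $t\notin\mathbb{Z}$ and $B_1^*(\{t\})=0$ if $t\in\mathbb{Z}$, where $\{t\}$ is the fractional part. Put $\mathcal P=\{2,3,5,7\}$, $L=\log x$ and $\ell_p=\log p$; the letters $a,b,c,d$ below denote elements of $\mathcal P$. For real $R>0$ and distinct $a,b,c,d\in\mathcal P$ define the partial sums $$P_{a,b}(R)=\sum_{k=1}^{\lfloor R\ell_a\rfloor}\frac{\cos\left(2\pi k\frac{L-\frac12\ell_b}{\ell_a}\right)}{k\sin\left(\frac{\pi k\ell_b}{\ell_a}\right)}+\sum_{k=1}^{\lfloor R\ell_b\rfloor}\frac{\cos\left(2\pi k\frac{L-\frac12\ell_a}{\ell_b}\right)}{k\sin\left(\frac{\pi k\ell_a}{\ell_b}\right)},$$ $$U_{a;b,c}(R)=\sum_{k=1}^{\lfloor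 R\ell_a\rfloor}\frac{\sin\left(2\pi k\frac{L+\frac12\ell_b-\frac12\ell_c}{\ell_a}\right)+\sin\left(2\pi k\frac{L-\frac12\ell_b+\frac12\ell_c}{\ell_a}\right)}{k\sin\left(\frac{\pi k\ell_b}{\ell_a}\right)\sin\left(\frac{\pi k\ell_c}{\ell_a}\right)},$$ $$V_{a;b,c,d}(R)=\sum_{k=1}^{\lfloor R\ell_a\rfloor}\frac{\cos\left(\frac{\pi k\ell_b}{\ell_a}\right)\cos\left(\frac{\pi k\ell_c}{\ell_a}\right)\cos\left(\frac{\pi k\ell_d}{\ell_a}\right)\cos\left(2\pi k\frac{L}{\ell_a}\right)}{k\sin\left(\frac{\pi k\ell_b}{\ell_a}\right)\sin\left(\frac{\pi k\ell_c}{\ell_a}\right)\sin\left(\frac{\pi k\ell_d}{\ell_a}\right)}.$$ Say that $F(R)\to l$ as $R\to\infty$ in the appropriate manner if, for every $\delta>0$, $F(R)\to l$ as $R\to\infty$ through those real $R$ for which each of $R\ell_2,R\ell_3,R\ell_5,R\ell_7$ has distance at least $\delta$ from the nearest integer. For some $\delta>0$ such $R$ are arbitrarily large (so these limits are unique). Then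 for every real $x\ge1$ the following limits, taken as $R\to\infty$ in the appropriate manner, exist and are finite: $\mathbf P_{a,b}=\lim P_{a,b}(R)$ for each pair $a<b$ in $\mathcal P$; $\mathbf T_{a,b,c}=\lim\bigl(U_{a;b,c}(R)+U_{b;a,c}(R)+U_{c;a,b}(R)\bigr)$ for each triple $a<b<c$ in $\mathcal P$; and $\mathbf Q=\lim\bigl(V_{2;3,5,7}(R)+V_{3;2,5,7}(R)+V_{5;2,3,7}(R)+V_{7;2,3,5}(R)\bigr)$. Moreover $$\begin{aligned} N_{2,3,5,7}(x)={}&\frac{L^4}{24\,\ell_2\ell_3\ell_5\ell_7}+\frac{L^3}{12}\sum_{a<b<c}\frac1{\ell_a\ell_b\ell_c}+\frac{L^2}{24}\sum_{a}\frac{\ell_a}{\prod_{q\ne a}\ell_q}+\frac{L^2}{8}\sum_{a<b}\frac1{\ell_a\ell_b}\\ &+\frac L8\sum_a\frac1{\ell_a}+\frac L{24}\sum_a\ \sum_{\substack{b<c\\ b,c\ne a}}\frac{\ell_a}{\ell_b\ell_c}+\frac1{16}+\frac1{48}\sum_{a\ne b}\frac{\ell_a}{\ell_b}\\ &+\frac1{144}\sum_{a<b}\frac{\ell_a\ell_b}{\prod_{q\ne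 a,b}\ell_q}-\frac1{720}\sum_a\frac{\ell_a^3}{\prod_{q\neq a}\ell_q}-\frac78\sum_{a}B_1^*\left(\left\{\frac{L}{\ell_a}\right\}\right)\\ &-\frac1{8\pi}\sum_{a<b}\mathbf P_{a,b}-\frac1{16\pi}\sum_{a<b<c}\mathbf T_{a,b,c}+\frac1{8\pi}\mathbf Q+\frac12\chi_{S_{2,3,5,7}}(x), \end{aligned}$$ where all sums and products run over elements of $\mathcal P$. -/

import Mathlib

open Filter Topology

/-- The number `N_{2,3,5,7}(x)` of quadruples of exponents `(p, q, l, f)`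
with `2^p * 3^q * 5^l * 7^f ≤ x`. -/
noncomputable def sevenSmoothCount (x : ℝ) : ℕ :=
  Set.ncard {e : ℕ × ℕ × ℕ × ℕ |
    (2 : ℝ) ^ e.1 * 3 ^ e.2.1 * 5 ^ e.2.2.1 * 7 ^ e.2.2.2 ≤ x}

/-- The set `S_{2,3,5,7}` of `7`-smooth numbers, as a set of real numbers. -/
def sevenSmoothSet : Set ℝ :=
  {y | ∃ p q l f : ℕ, y = (2 : ℝ) ^ p * 3 ^ q * 5 ^ l * 7 ^ f}

/-- The characteristic function of the set of `7`-smooth numbers. -/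
noncomputable def sevenSmoothChar (x : ℝ) : ℝ :=
  sevenSmoothSet.indicator (fun _ => (1 : ℝ)) x

open scoped Classical in
/-- `bernoulliStar t` is `B₁*({t})`: it is `{t} - 1/2` if `t` is not an integer, and `0` if it is. -/
noncomputable def bernoulliStar (t : ℝ) : ℝ :=
  if ∃ n : ℤ, (n : ℝ) = t then 0 else Int.fract t - 1 / 2

/-- The polynomial part of the formula, in `L = log x`, where `A, B, C, D` are the logarithms
of the four bases. -/
noncomputable def polyPart (A B C D L : ℝ) : ℝ :=
  L ^ 4 / (24 * A * B * C * D)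
    + L ^ 3 / (12 * A * B * C) + L ^ 3 / (12 * A * B * D)
    + L ^ 3 / (12 * A * C * D) + L ^ 3 / (12 * B * C * D)
    + A * L ^ 2 / (24 * B * C * D) + B * L ^ 2 / (24 * A * C * D)
    + C * L ^ 2 / (24 * A * B * D) + D * L ^ 2 / (24 * A * B * C)
    + L ^ 2 / (8 * A * B) + L ^ 2 / (8 * A * C) + L ^ 2 / (8 * A * D)
    + L ^ 2 / (8 * B * C) + L ^ 2 / (8 * B * D) + L ^ 2 / (8 * C * D)
    + L / (8 * A) + L / (8 * B) + L / (8 * C) + L / (8 * D)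
    + A * L / (24 * B * C) + A * L / (24 * B * D) + A * L / (24 * C * D)
    + B * L / (24 * A * C) + B * L / (24 * A * D) + B * L / (24 * C * D)
    + C * L / (24 * A * B) + C * L / (24 * A * D) + C * L / (24 * B * D)
    + D * L / (24 * A * B) + D * L / (24 * A * C) + D * L / (24 * B * C)
    + 1 / 16
    + A / (48 * B) + A / (48 * C) + A / (48 * D)
    + B / (48 * A) + B / (48 * C) + B / (48 * D)
    + C / (48 * A) + C / (48 * B) + C / (48 * D)
    + D / (48 * A) + D / (48 * B) + D / (48 * C)
    + A * B / (144 * C * D) + A * C / (144 * B * D) + A * D / (144 * B * C)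
    + B * C / (144 * A * D) + B * D / (144 * A * C) + C * D / (144 * A * B)
    - A ^ 3 / (720 * B * C * D) - B ^ 3 / (720 * A * C * D)
    - C ^ 3 / (720 * A * B * D) - D ^ 3 / (720 * A * B * C)

/-- The partial sum with parameter `R` of the series attached to the pair `a, b`:
`k` runs up to `⌊R log a⌋` in the terms with base `a` and up to `⌊R log b⌋` in those with base `b`. -/
noncomputable def pairSum (a b x R : ℝ) : ℝ :=
  (∑ k ∈ Finset.Icc 1 ⌊R * Real.log a⌋₊,
      Real.cos (2 * Real.pi * k * ((Real.log x - 1 / 2 * Real.log b) / Real.log a))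
        / (k * Real.sin (Real.pi * k * Real.log b / Real.log a)))
  + ∑ k ∈ Finset.Icc 1 ⌊R * Real.log b⌋₊,
      Real.cos (2 * Real.pi * k * ((Real.log x - 1 / 2 * Real.log a) / Real.log b))
        / (k * Real.sin (Real.pi * k * Real.log a / Real.log b))

/-- The partial sum with parameter `R` of the sine series with base `a` attached to `b, c`. -/
noncomputable def sineSum (a b c x R : ℝ) : ℝ :=
  ∑ k ∈ Finset.Icc 1 ⌊R * Real.log a⌋₊,
    (Real.sin (2 * Real.pi * k *
          ((Real.log x + 1 / 2 * Real.log b - 1 / 2 * Real.log c) / Real.log a))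
        / (k * Real.sin (Real.pi * k * Real.log b / Real.log a)
            * Real.sin (Real.pi * k * Real.log c / Real.log a))
      + Real.sin (2 * Real.pi * k *
          ((Real.log x - 1 / 2 * Real.log b + 1 / 2 * Real.log c) / Real.log a))
        / (k * Real.sin (Real.pi * k * Real.log b / Real.log a)
            * Real.sin (Real.pi * k * Real.log c / Real.log a)))

/-- The partial sum with parameter `R` of the cosine series with base `a` attached to `b, c, d`. -/
noncomputable def cosineSum (a b c d x R : ℝ) : ℝ :=
  ∑ k ∈ Finset.Icc 1 ⌊R * Real.log a⌋₊,
    Real.cos (Real.pi * k * Real.log b / Real.log a)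
        * Real.cos (Real.pi * k * Real.log c / Real.log a)
        * Real.cos (Real.pi * k * Real.log d / Real.log a)
        * Real.cos (2 * Real.pi * k * (Real.log x / Real.log a))
      / (k * Real.sin (Real.pi * k * Real.log b / Real.log a)
          * Real.sin (Real.pi * k * Real.log c / Real.log a)
          * Real.sin (Real.pi * k * Real.log d / Real.log a))

/-- `R → ∞` through the real numbers such that each of `R log 2`, `R log 3`, `R log 5`, `R log 7`
has distance at least `δ` from the integers, that is, such that none of the four cut-off points
`R log p` is close to a jump of its partial sum. -/
noncomputable def admissible (δ : ℝ) : Filter ℝ :=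
  atTop ⊓ 𝓟 {R : ℝ | ∀ p ∈ ({2, 3, 5, 7} : Set ℝ), ∀ n : ℤ, δ ≤ |R * Real.log p - n|}

/-- `F R` tends to `l` when `R → ∞` in the appropriate manner: for every `δ > 0`, along all `R`
that keep the cut-off points at distance at least `δ` from the integers. -/
def AppropriateLimit (F : ℝ → ℝ) (l : ℝ) : Prop :=
  ∀ δ : ℝ, 0 < δ → Tendsto F (admissible δ) (𝓝 l)

/-! For a finite set A of bases with logarithms l_i, let K_{A,L}(s) = e^{sL} / (s ∏_{i ∈ A} (1 -
e^{-s l_i})), the Perron integrand of the lattice point count. Its poles all lie on the imaginary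
axis: one at 0 of order |A| + 1, and the points 2πik/l_i with k ≠ 0, which are simple and distinct
because the l_i are incommensurable. By the residue theorem the integral of K around [-1, 1] ×
[-2πR, 2πR], divided by 2πi, is the residue at 0, a polynomial in L, plus a partial sum of the
residues at the other poles (`rectInt_kernel`).

The limit of this integral is found by a recursion. The identity K_{A∪b,L} = K_{A∪b,L-l_b} + K_{A,L}
(`kernel_insert`) mirrors the recursion of the count. It lowers L until -∑ l_i < L < 0, and there
the integral tends to 0 (`tendsto_rectInt_kernel_zero`): K decays exponentially in both horizontal
directions, the rectangle can be widened to infinity without meeting a pole, and the horizontal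
sides contribute O(1/R) as long as the R l_i stay away from the integers. Hence the limit is the
count, where combinations equal to L have weight 1/2 (`hasCount_weightedCount`).

It remains to read off the residues. Since 1/(1 - e^{-2iφ}) = (1 - i cot φ)/2, the residues at ±k
combine into sawtooth, pair, triple and quadruple terms (`poleResidue_add_one` to
`poleResidue_add_four`). Sets of one, two and three bases give in turn the convergence of the
sawtooth, pair and triple sums; four bases then give the convergence of the quadruple sums and the
formula itself (`tendstoAvoiding_quadResidueTerm`). -/

/-! ### Boundary integrals over rectangles centred at the origin -/

/-- The integral of `f` along the boundary of the rectangle `[-U, U] × [-T, T]`. -/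
noncomputable def rectInt (f : ℂ → ℂ) (U T : ℝ) : ℂ :=
  (∫ x : ℝ in (-U)..U, f (x + ((-T : ℝ) : ℂ) * Complex.I))
    - (∫ x : ℝ in (-U)..U, f (x + (T : ℂ) * Complex.I))
    + Complex.I * (∫ y : ℝ in (-T)..T, f ((U : ℂ) + y * Complex.I))
    - Complex.I * (∫ y : ℝ in (-T)..T, f (((-U : ℝ) : ℂ) + y * Complex.I))

/-- The boundary of the rectangle `[-U, U] × [-T, T]`. -/
def rectBoundary (U T : ℝ) : Set ℂ :=
  {s | |s.re| ≤ U ∧ |s.im| ≤ T ∧ (|s.re| = U ∨ |s.im| = T)}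

section rect

variable {U T : ℝ}

lemma horizontal_mem_rectBoundary {t x : ℝ} (ht : |t| = T)
    (hx : x ∈ Set.uIcc (-U) U) (hU : 0 ≤ U) :
    (x : ℂ) + (t : ℂ) * Complex.I ∈ rectBoundary U T := by
  rw [Set.uIcc_of_le (by linarith)] at hx
  simp only [rectBoundary, Set.mem_ofPred_eq, Complex.add_re, Complex.ofReal_re, Complex.mul_re,
    Complex.I_re, Complex.ofReal_im, Complex.I_im, Complex.add_im, Complex.mul_im]
  simp only [mul_zero, sub_zero, add_zero, mul_one, zero_add]
  exact ⟨abs_le.2 ⟨hx.1, hx.2⟩, ht.le, Or.inr ht⟩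

lemma vertical_mem_rectBoundary {u y : ℝ} (hu : |u| = U)
    (hy : y ∈ Set.uIcc (-T) T) (hT : 0 ≤ T) :
    (u : ℂ) + (y : ℂ) * Complex.I ∈ rectBoundary U T := by
  rw [Set.uIcc_of_le (by linarith)] at hy
  simp only [rectBoundary, Set.mem_ofPred_eq, Complex.add_re, Complex.ofReal_re, Complex.mul_re,
    Complex.I_re, Complex.ofReal_im, Complex.I_im, Complex.add_im, Complex.mul_im]
  simp only [mul_zero, sub_zero, add_zero, mul_one, zero_add]
  exact ⟨hu.le, abs_le.2 ⟨hy.1, hy.2⟩, Or.inl hu⟩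

lemma horizontal_continuousOn {f : ℂ → ℂ} (hU : 0 ≤ U)
    (hf : ContinuousOn f (rectBoundary U T)) {t : ℝ} (ht : |t| = T) :
    ContinuousOn (fun x : ℝ => f (x + (t : ℂ) * Complex.I)) (Set.uIcc (-U) U) :=
  hf.comp (by fun_prop) fun _ hx => horizontal_mem_rectBoundary ht hx hU

lemma vertical_continuousOn {f : ℂ → ℂ} (hT : 0 ≤ T)
    (hf : ContinuousOn f (rectBoundary U T)) {u : ℝ} (hu : |u| = U) :
    ContinuousOn (fun y : ℝ => f ((u : ℂ) + y * Complex.I)) (Set.uIcc (-T) T) :=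
  hf.comp (by fun_prop) fun _ hy => vertical_mem_rectBoundary hu hy hT

lemma rectInt_congr {f g : ℂ → ℂ} (hU : 0 ≤ U) (hT : 0 ≤ T)
    (h : Set.EqOn f g (rectBoundary U T)) : rectInt f U T = rectInt g U T := by
  have hT' : |(-T)| = T := by rw [abs_neg, abs_of_nonneg hT]
  have hU' : |(-U)| = U := by rw [abs_neg, abs_of_nonneg hU]
  unfold rectInt
  rw [intervalIntegral.integral_congr fun x hx => h (horizontal_mem_rectBoundary hT' hx hU),
    intervalIntegral.integral_congr fun x hx =>
      h (horizontal_mem_rectBoundary (abs_of_nonneg hT) hx hU),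
    intervalIntegral.integral_congr fun x hx =>
      h (vertical_mem_rectBoundary (abs_of_nonneg hU) hx hT),
    intervalIntegral.integral_congr fun x hx => h (vertical_mem_rectBoundary hU' hx hT)]

lemma rectInt_add {f g : ℂ → ℂ} (hU : 0 ≤ U) (hT : 0 ≤ T)
    (hf : ContinuousOn f (rectBoundary U T)) (hg : ContinuousOn g (rectBoundary U T)) :
    rectInt (fun s => f s + g s) U T = rectInt f U T + rectInt g U T := by
  have hT' : |(-T)| = T := by rw [abs_neg, abs_of_nonneg hT]
  have hU' : |(-U)| = U := by rw [abs_neg, abs_of_nonneg hU]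
  have hT0 := abs_of_nonneg hT
  have hU0 := abs_of_nonneg hU
  unfold rectInt
  rw [intervalIntegral.integral_add (horizontal_continuousOn hU hf hT').intervalIntegrable
      (horizontal_continuousOn hU hg hT').intervalIntegrable,
    intervalIntegral.integral_add (horizontal_continuousOn hU hf hT0).intervalIntegrable
      (horizontal_continuousOn hU hg hT0).intervalIntegrable,
    intervalIntegral.integral_add (vertical_continuousOn hT hf hU0).intervalIntegrable
      (vertical_continuousOn hT hg hU0).intervalIntegrable,
    intervalIntegral.integral_add (vertical_continuousOn hT hf hU').intervalIntegrable
      (vertical_continuousOn hT hg hU').intervalIntegrable]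
  ring

lemma rectInt_const_mul (c : ℂ) (f : ℂ → ℂ) :
    rectInt (fun s => c * f s) U T = c * rectInt f U T := by
  unfold rectInt
  simp only [intervalIntegral.integral_const_mul]
  ring

lemma rectInt_zero : rectInt (fun _ => 0) U T = 0 := by
  simp [rectInt]

lemma rectInt_sum {ι : Type*} (S : Finset ι) {f : ι → ℂ → ℂ} (hU : 0 ≤ U) (hT : 0 ≤ T)
    (hf : ∀ i ∈ S, ContinuousOn (f i) (rectBoundary U T)) :
    rectInt (fun s => ∑ i ∈ S, f i s) U T = ∑ i ∈ S, rectInt (f i) U T := by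
  classical
  induction S using Finset.induction_on with
  | empty => simpa using rectInt_zero
  | insert a S ha ih =>
    simp only [Finset.sum_insert ha]
    rw [rectInt_add hU hT (hf a (Finset.mem_insert_self a S))
      (continuousOn_finsetSum S fun i hi => hf i (Finset.mem_insert_of_mem hi)),
      ih fun i hi => hf i (Finset.mem_insert_of_mem hi)]

lemma rectInt_eq_zero_of_differentiableOn {f : ℂ → ℂ} (hU : 0 ≤ U) (hT : 0 ≤ T)
    (hf : ∀ s : ℂ, |s.re| ≤ U → |s.im| ≤ T → DifferentiableAt ℂ f s) :
    rectInt f U T = 0 := by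
  have h := Complex.integral_boundary_rect_eq_zero_of_differentiableOn f ⟨-U, -T⟩ ⟨U, T⟩ (by
    intro s hs
    rw [Complex.mem_reProdIm] at hs
    rw [Set.uIcc_of_le (by linarith), Set.uIcc_of_le (by linarith)] at hs
    exact (hf s (abs_le.2 hs.1) (abs_le.2 hs.2)).differentiableWithinAt)
  simpa [rectInt] using h

lemma rectInt_eq_zero_of_hasDerivAt {f F : ℂ → ℂ} (hU : 0 ≤ U) (hT : 0 ≤ T)
    (hf : ContinuousOn f (rectBoundary U T))
    (hF : ∀ s ∈ rectBoundary U T, HasDerivAt F (f s) s) :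
    rectInt f U T = 0 := by
  have hT' : |(-T)| = T := by rw [abs_neg, abs_of_nonneg hT]
  have hU' : |(-U)| = U := by rw [abs_neg, abs_of_nonneg hU]
  have hor : ∀ t : ℝ, |t| = T → (∫ x : ℝ in (-U)..U, f (x + (t : ℂ) * Complex.I))
      = F (U + (t : ℂ) * Complex.I) - F (((-U : ℝ) : ℂ) + (t : ℂ) * Complex.I) := by
    intro t ht
    refine intervalIntegral.integral_eq_sub_of_hasDerivAt
      (f := fun x : ℝ => F (x + (t : ℂ) * Complex.I)) (fun x hx => ?_)
      (horizontal_continuousOn hU hf ht).intervalIntegrable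
    have h1 := hF _ (horizontal_mem_rectBoundary ht hx hU)
    have h2 : HasDerivAt (fun x : ℝ => (x : ℂ) + (t : ℂ) * Complex.I) 1 x :=
      (Complex.ofRealCLM.hasDerivAt (x := x)).add_const _
    simpa [Function.comp_def] using HasDerivAt.comp x h1 h2
  have ver : ∀ u : ℝ, |u| = U → Complex.I * (∫ y : ℝ in (-T)..T, f ((u : ℂ) + y * Complex.I))
      = F (u + (T : ℂ) * Complex.I) - F (u + ((-T : ℝ) : ℂ) * Complex.I) := by
    intro u hu
    rw [← intervalIntegral.integral_const_mul]
    refine intervalIntegral.integral_eq_sub_of_hasDerivAt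
      (f := fun y : ℝ => F (u + (y : ℂ) * Complex.I)) (fun y hy => ?_)
      (continuousOn_const.mul (vertical_continuousOn hT hf hu)).intervalIntegrable
    have h1 := hF _ (vertical_mem_rectBoundary hu hy hT)
    have h2 : HasDerivAt (fun y : ℝ => (u : ℂ) + (y : ℂ) * Complex.I) Complex.I y := by
      simpa using ((Complex.ofRealCLM.hasDerivAt (x := y)).mul_const Complex.I).const_add (u : ℂ)
    simpa [Function.comp_def, mul_comm] using HasDerivAt.comp y h1 h2
  unfold rectInt
  rw [hor _ hT', hor _ (abs_of_nonneg hT), ver _ hU', ver _ (abs_of_nonneg hU)]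
  ring

lemma log_I_mul {w : ℂ} (hw : 0 < w.re) :
    Complex.log (Complex.I * w) = Complex.log w + Complex.I * (Real.pi / 2) := by
  have hw0 : w ≠ 0 := fun h => by simp [h] at hw
  have h1 : |w.arg| < Real.pi / 2 := Complex.abs_arg_lt_pi_div_two_iff.2 (Or.inl hw)
  rw [abs_lt] at h1
  rw [Complex.log_mul Complex.I_ne_zero hw0, Complex.log_I]
  · ring
  · rw [Complex.arg_I]
    constructor <;> linarith [Real.pi_pos]

/-- The factor u rotates the segment into the right half-plane, where the principal logarithm is a
primitive; a constant factor does not change the logarithmic derivative. -/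
lemma integral_inv_segment (u c d : ℂ) (a b : ℝ) (hu : u ≠ 0)
    (h : ∀ x ∈ Set.uIcc a b, 0 < (u * (c + x * d)).re) :
    d * (∫ x : ℝ in a..b, (c + x * d)⁻¹)
      = Complex.log (u * (c + b * d)) - Complex.log (u * (c + a * d)) := by
  have hne : ∀ x ∈ Set.uIcc a b, c + (x : ℂ) * d ≠ 0 := by
    intro x hx h0
    have := h x hx
    simp [h0] at this
  rw [← intervalIntegral.integral_const_mul]
  refine intervalIntegral.integral_eq_sub_of_hasDerivAt
    (f := fun x : ℝ => Complex.log (u * (c + x * d))) (fun x hx => ?_) ?_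
  · have h2 : HasDerivAt (fun x : ℝ => u * (c + (x : ℂ) * d)) (u * d) x := by
      simpa using (((Complex.ofRealCLM.hasDerivAt (x := x)).mul_const d).const_add c).const_mul u
    have h3 := h2.clog_real (Or.inl (h x hx))
    rwa [mul_div_mul_left _ _ hu, div_eq_mul_inv] at h3
  · apply ContinuousOn.intervalIntegrable
    refine continuousOn_const.mul (ContinuousOn.inv₀ (by fun_prop) hne)

/-- The four sides are rotated by i, 1, -i and -1. At each corner the two logarithms that meet there
differ by iπ/2, and these four jumps add up to 2πi. -/
lemma rectInt_inv_sub {p : ℂ} (hp : |p.re| < U) (hp' : |p.im| < T) :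
    rectInt (fun s => (s - p)⁻¹) U T = 2 * Real.pi * Complex.I := by
  rw [abs_lt] at hp hp'
  have hU : -U ≤ U := by linarith
  have hT : -T ≤ T := by linarith
  have e1 := integral_inv_segment Complex.I (((-T : ℝ) : ℂ) * Complex.I - p) 1 (-U) U
    Complex.I_ne_zero (by intro x hx; simp; linarith)
  have e2 := integral_inv_segment (-Complex.I) ((T : ℂ) * Complex.I - p) 1 (-U) U
    (neg_ne_zero.2 Complex.I_ne_zero) (by intro x hx; simp; linarith)
  have e3 := integral_inv_segment 1 ((U : ℂ) - p) Complex.I (-T) T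
    one_ne_zero (by intro x hx; simp; linarith)
  have e4 := integral_inv_segment (-1) (((-U : ℝ) : ℂ) - p) Complex.I (-T) T
    (by simp) (by intro x hx; simp; linarith)
  have c1 := log_I_mul (w := (U : ℂ) - p + ((-T : ℝ) : ℂ) * Complex.I)
    (by simp; linarith)
  have c2 := log_I_mul (w := -Complex.I * ((T : ℂ) * Complex.I - p + (U : ℂ) * 1))
    (by simp; linarith)
  have c3 := log_I_mul (w := -1 * (((-U : ℝ) : ℂ) - p + (T : ℂ) * Complex.I))
    (by simp; linarith)
  have c4 := log_I_mul (w := Complex.I * (((-T : ℝ) : ℂ) * Complex.I - p + ((-U : ℝ) : ℂ) * 1))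
    (by simp; linarith)
  have I2 : Complex.I * Complex.I = -1 := Complex.I_mul_I
  have k1 : Complex.I * (((-T : ℝ) : ℂ) * Complex.I - p + (U : ℂ) * 1)
      = Complex.I * ((U : ℂ) - p + ((-T : ℝ) : ℂ) * Complex.I) := by ring
  have k2 : Complex.I * (-Complex.I * ((T : ℂ) * Complex.I - p + (U : ℂ) * 1))
      = 1 * ((U : ℂ) - p + (T : ℂ) * Complex.I) := by
    linear_combination (-((T : ℂ) * Complex.I - p + (U : ℂ) * 1)) * I2
  have k3 : -Complex.I * ((T : ℂ) * Complex.I - p + ((-U : ℝ) : ℂ) * 1)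
      = Complex.I * (-1 * (((-U : ℝ) : ℂ) - p + (T : ℂ) * Complex.I)) := by ring
  have k4 : Complex.I * (Complex.I * (((-T : ℝ) : ℂ) * Complex.I - p + ((-U : ℝ) : ℂ) * 1))
      = -1 * (((-U : ℝ) : ℂ) - p + ((-T : ℝ) : ℂ) * Complex.I) := by
    linear_combination (((-T : ℝ) : ℂ) * Complex.I - p + ((-U : ℝ) : ℂ) * 1) * I2
  rw [k1, c1] at e1
  rw [k3, c3] at e2
  rw [← k2, c2, one_mul] at e3
  rw [← k4, c4] at e4
  rw [one_mul] at e1 e2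
  unfold rectInt
  have r1 : ∀ (x t : ℝ), ((x : ℂ) + (t : ℂ) * Complex.I - p)⁻¹
      = ((t : ℂ) * Complex.I - p + (x : ℂ) * 1)⁻¹ := fun x t => by ring_nf
  have r2 : ∀ (u y : ℝ), ((u : ℂ) + (y : ℂ) * Complex.I - p)⁻¹
      = ((u : ℂ) - p + (y : ℂ) * Complex.I)⁻¹ := fun x t => by ring_nf
  simp only [r1]
  rw [e1, e2]
  simp only [← r1, r2]
  rw [e3, e4]
  ring

lemma sub_ne_zero_of_mem_rectBoundary {p s : ℂ} (hp : |p.re| < U) (hp' : |p.im| < T)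
    (hs : s ∈ rectBoundary U T) : s - p ≠ 0 := by
  intro h
  rw [sub_eq_zero] at h
  subst h
  rcases hs.2.2 with h | h <;> linarith

lemma rectInt_inv_pow {p : ℂ} (hp : |p.re| < U) (hp' : |p.im| < T) (n : ℕ) :
    rectInt (fun s => ((s - p) ^ (n + 2))⁻¹) U T = 0 := by
  have hU : 0 ≤ U := (abs_nonneg _).trans hp.le
  have hT : 0 ≤ T := (abs_nonneg _).trans hp'.le
  have hne := fun s => sub_ne_zero_of_mem_rectBoundary (s := s) hp hp'
  refine rectInt_eq_zero_of_hasDerivAt (F := fun s => (-(n + 1 : ℂ))⁻¹ * ((s - p) ^ (n + 1))⁻¹)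
    hU hT (ContinuousOn.inv₀ (by fun_prop) fun s hs => pow_ne_zero _ (hne s hs)) fun s hs => ?_
  have h0 := hne s hs
  have hn : (n + 1 : ℂ) ≠ 0 := by exact_mod_cast Nat.succ_ne_zero n
  have h1 := ((((hasDerivAt_id s).sub_const p).pow (n + 1)).inv (pow_ne_zero _ h0)).const_mul
    ((-(n + 1 : ℂ))⁻¹)
  refine HasDerivAt.congr_deriv h1 ?_
  simp only [id, Nat.add_sub_cancel, mul_one, Pi.pow_apply]
  push_cast
  field_simp
  ring

/-- The residue theorem on a rectangle, for poles of order at most `N`. -/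
theorem rectInt_eq_sum_residues {f : ℂ → ℂ} (S : Finset ℂ) (N : ℕ) (c : ℂ → ℕ → ℂ)
    (hU : 0 ≤ U) (hT : 0 ≤ T)
    (hS : ∀ p ∈ S, |p.re| < U ∧ |p.im| < T)
    (hf : ∀ s : ℂ, |s.re| ≤ U → |s.im| ≤ T → s ∉ S → DifferentiableAt ℂ f s)
    (hp : ∀ p ∈ S, ∃ g : ℂ → ℂ, AnalyticAt ℂ g p ∧
      ∀ᶠ s in 𝓝[≠] p, f s = (∑ j ∈ Finset.range (N + 1), c p j * ((s - p) ^ (j + 1))⁻¹) + g s) :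
    rectInt f U T = 2 * Real.pi * Complex.I * ∑ p ∈ S, c p 0 := by
  classical
  have hne : ∀ p ∈ S, ∀ s ∈ rectBoundary U T, s - p ≠ 0 := fun p hpS s hs =>
    sub_ne_zero_of_mem_rectBoundary (hS p hpS).1 (hS p hpS).2 hs
  set P : ℂ → ℂ → ℂ := fun p s => ∑ j ∈ Finset.range (N + 1), c p j * ((s - p) ^ (j + 1))⁻¹
    with hP
  have hPdiff : ∀ p s, s - p ≠ 0 → AnalyticAt ℂ (P p) s := by
    intro p s hs
    rw [hP]
    refine Finset.analyticAt_fun_sum _ fun j _ => ?_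
    exact analyticAt_const.mul (AnalyticAt.inv (by fun_prop) (pow_ne_zero _ hs))
  have hPint : ∀ p ∈ S, rectInt (P p) U T = 2 * Real.pi * Complex.I * c p 0 := by
    intro p hpS
    rw [show P p = fun s => ∑ j ∈ Finset.range (N + 1), c p j * ((s - p) ^ (j + 1))⁻¹ from rfl,
      rectInt_sum _ hU hT]
    · simp only [rectInt_const_mul]
      rw [Finset.sum_range_succ']
      simp only [add_assoc, Nat.reduceAdd, rectInt_inv_pow (hS p hpS).1 (hS p hpS).2, mul_zero,
        Finset.sum_const_zero, zero_add, pow_one, rectInt_inv_sub (hS p hpS).1 (hS p hpS).2]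
      ring
    · intro j _
      exact continuousOn_const.mul (ContinuousOn.inv₀ (by fun_prop) fun s hs =>
        pow_ne_zero _ (hne p hpS s hs))
  -- the regular part of `f` near `p`
  choose! g hg hfg using hp
  -- `f` minus all principal parts. At a pole the value of `f` is arbitrary, so it is replaced there
  -- by the value that removes the singularity.
  set h : ℂ → ℂ := fun s =>
    if s ∈ S then g s s - ∑ q ∈ S.erase s, P q s else f s - ∑ q ∈ S, P q s with hh
  have hSclosed : ∀ s, s ∉ S → ∀ᶠ z in 𝓝 s, z ∉ S := fun s hs =>
    S.finite_toSet.isClosed.isOpen_compl.mem_nhds hs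
  have hhdiff : ∀ s : ℂ, |s.re| ≤ U → |s.im| ≤ T → DifferentiableAt ℂ h s := by
    intro s hs1 hs2
    by_cases hs : s ∈ S
    · have : h =ᶠ[𝓝 s] fun z => g s z - ∑ q ∈ S.erase s, P q z := by
        have h1 := hfg s hs
        rw [eventually_nhdsWithin_iff] at h1
        have h2 : ∀ᶠ z in 𝓝 s, z ∉ S.erase s :=
          (S.erase s).finite_toSet.isClosed.isOpen_compl.mem_nhds (by simp)
        filter_upwards [h1, h2] with z hz1 hz2
        by_cases hzs : z = s
        · subst hzs
          simp [hh, hs]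
        · have hz : z ∉ S := fun hz => hz2 (Finset.mem_erase.2 ⟨hzs, hz⟩)
          have := hz1 hzs
          simp only [hh, hz, if_false]
          rw [this, ← Finset.add_sum_erase S _ hs]
          simp only [hP]
          ring
      refine DifferentiableAt.congr_of_eventuallyEq ?_ this
      refine (hg s hs).differentiableAt.sub ?_
      refine DifferentiableAt.fun_sum fun q hq => (hPdiff q s ?_).differentiableAt
      exact sub_ne_zero.2 (Finset.ne_of_mem_erase hq).symm
    · have : h =ᶠ[𝓝 s] fun z => f z - ∑ q ∈ S, P q z := by
        filter_upwards [hSclosed s hs] with z hz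
        simp [hh, hz]
      refine DifferentiableAt.congr_of_eventuallyEq ?_ this
      refine (hf s hs1 hs2 hs).sub ?_
      refine DifferentiableAt.fun_sum fun q hq => (hPdiff q s ?_).differentiableAt
      exact sub_ne_zero.2 fun h => hs (h ▸ hq)
  have hbd : ∀ s ∈ rectBoundary U T, s ∉ S := fun s hs hsS => hne s hsS s hs (sub_self s)
  have hdecomp : Set.EqOn f (fun s => h s + ∑ q ∈ S, P q s) (rectBoundary U T) := by
    intro s hs
    simp [hh, hbd s hs]
  have hPc : ∀ q ∈ S, ContinuousOn (P q) (rectBoundary U T) := fun q hq s hs =>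
    (hPdiff q s (hne q hq s hs)).continuousAt.continuousWithinAt
  rw [rectInt_congr hU hT hdecomp, rectInt_add hU hT
    (fun s hs => (hhdiff s hs.1 hs.2.1).continuousAt.continuousWithinAt)
    (continuousOn_finsetSum S hPc), rectInt_eq_zero_of_differentiableOn hU hT hhdiff,
    rectInt_sum S hU hT hPc, Finset.sum_congr rfl hPint, zero_add, Finset.mul_sum]

end rect

/-- The residue theorem on a rectangle, for an indexed family of poles. -/
theorem rectInt_eq_sum_residues_of_injOn {κ : Type*} {U T : ℝ} {f : ℂ → ℂ} (S : Finset κ)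
    (pt : κ → ℂ) (N : ℕ) (c : κ → ℕ → ℂ) (hinj : Set.InjOn pt S)
    (hU : 0 ≤ U) (hT : 0 ≤ T)
    (hS : ∀ i ∈ S, |(pt i).re| < U ∧ |(pt i).im| < T)
    (hf : ∀ s : ℂ, |s.re| ≤ U → |s.im| ≤ T → (∀ i ∈ S, s ≠ pt i) → DifferentiableAt ℂ f s)
    (hp : ∀ i ∈ S, ∃ g : ℂ → ℂ, AnalyticAt ℂ g (pt i) ∧ ∀ᶠ s in 𝓝[≠] (pt i),
      f s = (∑ j ∈ Finset.range (N + 1), c i j * ((s - pt i) ^ (j + 1))⁻¹) + g s) :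
    rectInt f U T = 2 * Real.pi * Complex.I * ∑ i ∈ S, c i 0 := by
  classical
  rcases isEmpty_or_nonempty κ with hκ | hκ
  · have h := rectInt_eq_zero_of_differentiableOn (f := f) hU hT fun s h1 h2 =>
      hf s h1 h2 fun i => hκ.elim i
    rw [h, Finset.eq_empty_of_isEmpty S]
    simp
  have hinv : ∀ i ∈ S, Function.invFunOn pt S (pt i) = i := fun i hi =>
    hinj (Function.invFunOn_mem ⟨i, hi, rfl⟩) hi (Function.invFunOn_eq ⟨i, hi, rfl⟩)
  rw [rectInt_eq_sum_residues (S.image pt) N (fun p => c (Function.invFunOn pt S p)) hU hT,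
    Finset.sum_image hinj, Finset.sum_congr rfl fun i hi => by rw [hinv i hi]]
  · intro p hpS
    obtain ⟨i, hi, rfl⟩ := Finset.mem_image.1 hpS
    exact hS i hi
  · intro s h1 h2 hs
    exact hf s h1 h2 fun i hi h => hs (Finset.mem_image.2 ⟨i, hi, h.symm⟩)
  · intro p hpS
    obtain ⟨i, hi, rfl⟩ := Finset.mem_image.1 hpS
    simpa only [hinv i hi] using hp i hi

/-- The difference quotient has the power series of `f` shifted by one. It serves to divide out a
simple zero. -/
lemma AnalyticAt.dslope_same {f : ℂ → ℂ} {p : ℂ} (hf : AnalyticAt ℂ f p) :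
    AnalyticAt ℂ (dslope f p) p := by
  obtain ⟨q, hq⟩ := hf
  exact ⟨_, hq.has_fpower_series_dslope_fslope⟩

/-! ### Taylor expansions to order five -/

/-- `f` agrees with `∑_{j < 5} a j * s ^ j` up to `s ^ 5` times an analytic function, near `0`. -/
def HasTaylor (f : ℂ → ℂ) (a : ℕ → ℂ) : Prop :=
  ∃ r : ℂ → ℂ, AnalyticAt ℂ r 0 ∧
    ∀ᶠ s in 𝓝[≠] (0 : ℂ), f s = (∑ j ∈ Finset.range 5, a j * s ^ j) + s ^ 5 * r s

lemma HasTaylor.mul {f g : ℂ → ℂ} {a b : ℕ → ℂ} (hf : HasTaylor f a) (hg : HasTaylor g b) :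
    HasTaylor (fun s => f s * g s) (fun n => ∑ i ∈ Finset.range (n + 1), a i * b (n - i)) := by
  obtain ⟨r, hr, hfr⟩ := hf
  obtain ⟨q, hq, hgq⟩ := hg
  -- The last bracket collects the terms of degree 5 to 8 in the product of the two truncated
  -- polynomials, divided by s ^ 5.
  refine ⟨fun s => r s * (∑ j ∈ Finset.range 5, b j * s ^ j)
    + (∑ j ∈ Finset.range 5, a j * s ^ j) * q s + s ^ 5 * (r s * q s)
    + ((a 1 * b 4 + a 2 * b 3 + a 3 * b 2 + a 4 * b 1) + (a 2 * b 4 + a 3 * b 3 + a 4 * b 2) * s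
      + (a 3 * b 4 + a 4 * b 3) * s ^ 2 + a 4 * b 4 * s ^ 3), ?_, ?_⟩
  · have h1 : AnalyticAt ℂ (fun s : ℂ => ∑ j ∈ Finset.range 5, b j * s ^ j) 0 := by fun_prop
    have h2 : AnalyticAt ℂ (fun s : ℂ => ∑ j ∈ Finset.range 5, a j * s ^ j) 0 := by fun_prop
    fun_prop
  · filter_upwards [hfr, hgq] with s h1 h2
    rw [h1, h2]
    simp only [Finset.sum_range_succ, Finset.sum_range_zero, zero_add, Nat.sub_zero,
      Nat.reduceSub]
    ring

lemma HasTaylor.congr {f g : ℂ → ℂ} {a : ℕ → ℂ} (hf : HasTaylor f a) (h : ∀ s, g s = f s) :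
    HasTaylor g a := by
  rwa [funext h]

lemma hasTaylor_one : HasTaylor (fun _ => 1) (fun n => if n = 0 then 1 else 0) :=
  ⟨fun _ => 0, analyticAt_const, by simp⟩

lemma hasTaylor_prod_exists {ι : Type*} (A : Finset ι) {f : ι → ℂ → ℂ}
    (h : ∀ i ∈ A, ∃ a, HasTaylor (f i) a) : ∃ a, HasTaylor (fun s => ∏ i ∈ A, f i s) a := by
  classical
  induction A using Finset.induction_on with
  | empty => exact ⟨_, hasTaylor_one.congr fun s => by simp⟩
  | insert i A hi ih =>
    obtain ⟨a, ha⟩ := h i (Finset.mem_insert_self i A)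
    obtain ⟨b, hb⟩ := ih fun j hj => h j (Finset.mem_insert_of_mem hj)
    exact ⟨_, (ha.mul hb).congr fun s => by rw [Finset.prod_insert hi]⟩

lemma hasDerivAt_exp_sub_sum (m : ℕ) (z : ℂ) :
    HasDerivAt (fun z => Complex.exp z - ∑ i ∈ Finset.range (m + 1), z ^ i / (i.factorial : ℂ))
      (Complex.exp z - ∑ i ∈ Finset.range m, z ^ i / (i.factorial : ℂ)) z := by
  refine (Complex.hasDerivAt_exp z).sub ?_
  induction m with
  | zero => simpa using hasDerivAt_const z (1 : ℂ)
  | succ m ih =>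
    have h : HasDerivAt (fun z : ℂ => z ^ (m + 1) / ((m + 1).factorial : ℂ))
        (z ^ m / (m.factorial : ℂ)) z := by
      refine ((hasDerivAt_pow (m + 1) z).div_const _).congr_deriv ?_
      rw [Nat.factorial_succ]
      have : (m.factorial : ℂ) ≠ 0 := by exact_mod_cast m.factorial_ne_zero
      have : (m + 1 : ℂ) ≠ 0 := by exact_mod_cast m.succ_ne_zero
      push_cast
      field_simp
    rw [Finset.sum_range_succ (fun i => z ^ i / (i.factorial : ℂ)) m]
    refine (ih.add h).congr_of_eventuallyEq (Eventually.of_forall fun y => ?_)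
    simp [Finset.sum_range_succ _ (m + 1)]

/-- Differentiating the remainder of index m + 1 gives the remainder of index m, and each remainder
of positive index vanishes at 0. So the order of vanishing grows by one at each step. -/
lemma exp_eq_sum_add_pow_mul (m : ℕ) : ∃ r : ℂ → ℂ, AnalyticAt ℂ r 0 ∧
    ∀ᶠ z in 𝓝 (0 : ℂ),
      Complex.exp z = (∑ i ∈ Finset.range m, z ^ i / (i.factorial : ℂ)) + z ^ m * r z := by
  have han : ∀ m : ℕ, AnalyticAt ℂ
      (fun z => Complex.exp z - ∑ i ∈ Finset.range m, z ^ i / (i.factorial : ℂ)) 0 := by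
    intro m
    refine Differentiable.analyticAt (fun z => ?_) 0
    refine Complex.differentiableAt_exp.sub ?_
    fun_prop
  have key : (m : ℕ∞) ≤ analyticOrderAt
      (fun z => Complex.exp z - ∑ i ∈ Finset.range m, z ^ i / (i.factorial : ℂ)) 0 := by
    induction m with
    | zero => simp
    | succ m ih =>
      have h := (han (m + 1)).analyticOrderAt_deriv_add_one
      rw [funext fun z => (hasDerivAt_exp_sub_sum m z).deriv] at h
      have h0 : (fun z : ℂ => (Complex.exp z
          - ∑ i ∈ Finset.range (m + 1), z ^ i / (i.factorial : ℂ))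
          - (Complex.exp 0 - ∑ i ∈ Finset.range (m + 1), (0 : ℂ) ^ i / (i.factorial : ℂ)))
          = fun z => Complex.exp z - ∑ i ∈ Finset.range (m + 1), z ^ i / (i.factorial : ℂ) := by
        funext z
        simp [Finset.sum_range_succ']
      rw [h0] at h
      rw [← h]
      push_cast
      gcongr
  obtain ⟨r, hr, h⟩ := (natCast_le_analyticOrderAt (han m)).1 key
  refine ⟨r, hr, h.mono fun z hz => ?_⟩
  simp only [sub_zero, smul_eq_mul] at hz
  rw [← hz]
  ring

lemma exp_mul_eq_sum_add_pow_mul (m : ℕ) (c : ℂ) : ∃ r : ℂ → ℂ, AnalyticAt ℂ r 0 ∧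
    ∀ᶠ s in 𝓝 (0 : ℂ),
      Complex.exp (s * c) = (∑ i ∈ Finset.range m, (s * c) ^ i / (i.factorial : ℂ))
        + (s * c) ^ m * r s := by
  obtain ⟨r, hr, h⟩ := exp_eq_sum_add_pow_mul m
  refine ⟨fun s => r (s * c), ?_, ?_⟩
  · exact AnalyticAt.fun_comp (by simpa using hr) (by fun_prop)
  · have : Tendsto (fun s : ℂ => s * c) (𝓝 0) (𝓝 0) := by
      have : Continuous fun s : ℂ => s * c := by fun_prop
      simpa using this.tendsto 0
    exact this.eventually h

lemma hasTaylor_exp (c : ℂ) :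
    HasTaylor (fun s => Complex.exp (s * c)) (fun j => c ^ j / (j.factorial : ℂ)) := by
  obtain ⟨r, hr, h⟩ := exp_mul_eq_sum_add_pow_mul 5 c
  refine ⟨fun s => c ^ 5 * r s, by fun_prop, (h.filter_mono nhdsWithin_le_nhds).mono fun s hs => ?_⟩
  dsimp only
  rw [hs]
  congr 1
  · exact Finset.sum_congr rfl fun j _ => by rw [mul_pow]; ring
  · ring

/-- The first Taylor coefficients of `s / (1 - exp (-s * ℓ))` at `0`. -/
noncomputable def toddCoeff (l : ℂ) : ℕ → ℂ
  | 0 => 1 / l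
  | 1 => 1 / 2
  | 2 => l / 12
  | 4 => -l ^ 3 / 720
  | _ => 0

/-- Write 1 - e^{-sl} = s q(s) with q(0) = l, and let t be the claimed polynomial. Then q t = 1 +
s^5 k, so the quotient is 1/q = t - s^5 k/q. The exponential is expanded to order 6 because one
power of s is divided out. At s = 0 the Lean quotient is 0, hence the punctured neighbourhood in
`HasTaylor`. -/
lemma hasTaylor_todd {l : ℂ} (hl : l ≠ 0) :
    HasTaylor (fun s => s / (1 - Complex.exp (-(s * l)))) (toddCoeff l) := by
  obtain ⟨r, hr, h⟩ := exp_mul_eq_sum_add_pow_mul 6 (-l)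
  set q : ℂ → ℂ := fun s => l - l ^ 2 * s / 2 + l ^ 3 * s ^ 2 / 6 - l ^ 4 * s ^ 3 / 24
    + l ^ 5 * s ^ 4 / 120 - l ^ 6 * s ^ 5 * r s with hq
  set t : ℂ → ℂ := fun s => 1 / l + s / 2 + l * s ^ 2 / 12 - l ^ 3 * s ^ 4 / 720 with ht
  -- Found by multiplying out q t; all terms of degree 1 to 4 cancel.
  set k : ℂ → ℂ := fun s => l ^ 5 / 720 + l ^ 6 * s / 2160 + l ^ 7 * s ^ 2 / 17280
    - l ^ 8 * s ^ 3 / 86400 - l ^ 6 * r s * t s with hk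
  have hqa : AnalyticAt ℂ q 0 := by rw [hq]; fun_prop
  have hq0 : q 0 ≠ 0 := by simpa [hq] using hl
  have hka : AnalyticAt ℂ k 0 := by
    have : AnalyticAt ℂ t 0 := by rw [ht]; fun_prop
    rw [hk]; fun_prop
  refine ⟨fun s => -(k s * (q s)⁻¹), (hka.mul (hqa.inv hq0)).neg, ?_⟩
  have hne : ∀ᶠ s in 𝓝[≠] (0 : ℂ), q s ≠ 0 :=
    (hqa.continuousAt.eventually_ne hq0).filter_mono nhdsWithin_le_nhds
  filter_upwards [hne, h.filter_mono nhdsWithin_le_nhds, self_mem_nhdsWithin] with s h1 h2 h3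
  have h3 : s ≠ 0 := h3
  have e1 : 1 - Complex.exp (-(s * l)) = s * q s := by
    rw [← mul_neg, h2]
    simp only [hq, Finset.sum_range_succ, Finset.sum_range_zero, Nat.factorial]
    push_cast
    ring
  have e2 : q s * t s = 1 + s ^ 5 * k s := by
    simp only [hq, hk, ht]
    field_simp
    ring
  have e3 : (∑ j ∈ Finset.range 5, toddCoeff l j * s ^ j) = t s := by
    simp only [ht, Finset.sum_range_succ, Finset.sum_range_zero, toddCoeff]
    ring
  rw [e3, e1]
  field_simp
  linear_combination -e2

/-! ### The kernel `exp (s * L) / (s * ∏ (1 - exp (-s * ℓ i)))` and its residues -/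

lemma sum_Icc_int_erase_zero (f : ℤ → ℂ) (N : ℕ) :
    ∑ k ∈ (Finset.Icc (-(N : ℤ)) N).erase 0, f k
      = ∑ k ∈ Finset.Icc 1 N, (f k + f (-(k : ℤ))) := by
  induction N with
  | zero => simp
  | succ N ih =>
    rw [Finset.sum_Icc_succ_top (by omega), ← ih]
    have : (Finset.Icc (-((N + 1 : ℕ) : ℤ)) ((N + 1 : ℕ) : ℤ)).erase 0
        = insert ((N + 1 : ℕ) : ℤ) (insert (-((N + 1 : ℕ) : ℤ))
          ((Finset.Icc (-(N : ℤ)) N).erase 0)) := by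
      ext k
      simp only [Finset.mem_erase, Finset.mem_Icc, Finset.mem_insert]
      omega
    rw [this, Finset.sum_insert, Finset.sum_insert]
    · ring
    · simp
    · simp only [Finset.mem_erase, Finset.mem_Icc, Finset.mem_insert]
      omega

section kernel

variable {ι : Type*} (l : ι → ℝ)

/-- The integrand of the inverse Laplace transform of the lattice point count. -/
noncomputable def kernel (A : Finset ι) (L : ℝ) (s : ℂ) : ℂ :=
  Complex.exp (s * L) / (s * ∏ i ∈ A, (1 - Complex.exp (-(s * l i))))

/-- The `k`-th zero of `1 - exp (-s * l i)`. -/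
noncomputable def pole (i : ι) (k : ℤ) : ℂ := ((2 * Real.pi * k / l i : ℝ) : ℂ) * Complex.I

/-- The numbers `l i` are positive and pairwise linearly independent over `ℚ`. -/
structure Incommensurable : Prop where
  pos : ∀ i, 0 < l i
  ne : ∀ i j, i ≠ j → ∀ k m : ℤ, k ≠ 0 → (k : ℝ) * l j ≠ m * l i

variable {l}

lemma pole_re (i : ι) (k : ℤ) : (pole l i k).re = 0 := by
  simp only [pole, Complex.re_ofReal_mul, Complex.I_re, mul_zero]

lemma pole_im (i : ι) (k : ℤ) : (pole l i k).im = 2 * Real.pi * k / l i := by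
  simp only [pole, Complex.im_ofReal_mul, Complex.I_im, mul_one]

lemma one_sub_exp_eq_zero_iff {a : ℝ} (ha : a ≠ 0) (s : ℂ) :
    1 - Complex.exp (-(s * a)) = 0 ↔
      ∃ k : ℤ, s = ((2 * Real.pi * k / a : ℝ) : ℂ) * Complex.I := by
  have ha' : (a : ℂ) ≠ 0 := by exact_mod_cast ha
  rw [sub_eq_zero, eq_comm, Complex.exp_eq_one_iff]
  constructor
  · rintro ⟨n, hn⟩
    refine ⟨-n, ?_⟩
    push_cast
    field_simp
    linear_combination -hn
  · rintro ⟨k, rfl⟩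
    refine ⟨-k, ?_⟩
    push_cast
    field_simp

lemma one_sub_exp_pole_same (hl : Incommensurable l) (i : ι) (k : ℤ) :
    1 - Complex.exp (-(pole l i k * l i)) = 0 :=
  (one_sub_exp_eq_zero_iff (hl.pos i).ne' _).2 ⟨k, rfl⟩

lemma pole_eq_pole_iff (hl : Incommensurable l) (i j : ι) (k m : ℤ) :
    pole l i k = pole l j m ↔ (k : ℝ) * l j = m * l i := by
  have h1 := (hl.pos i).ne'
  have h2 := (hl.pos j).ne'
  have h3 := Real.pi_pos.ne'
  rw [Complex.ext_iff, pole_re, pole_re, pole_im, pole_im, div_eq_div_iff h1 h2]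
  constructor
  · rintro ⟨-, h⟩
    have : 2 * Real.pi * ((k : ℝ) * l j - m * l i) = 0 := by linear_combination h
    simpa [h3, sub_eq_zero] using this
  · intro h
    exact ⟨rfl, by linear_combination 2 * Real.pi * h⟩

lemma one_sub_exp_pole_ne_zero (hl : Incommensurable l) {i j : ι} (hij : i ≠ j) {k : ℤ}
    (hk : k ≠ 0) : 1 - Complex.exp (-(pole l i k * l j)) ≠ 0 := by
  rw [Ne, one_sub_exp_eq_zero_iff (hl.pos j).ne']
  rintro ⟨m, hm⟩
  exact hl.ne i j hij k m hk ((pole_eq_pole_iff hl i j k m).1 hm)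

lemma pole_ne_zero (hl : Incommensurable l) (i : ι) {k : ℤ} (hk : k ≠ 0) : pole l i k ≠ 0 := by
  intro h
  have := congrArg Complex.im h
  rw [pole_im] at this
  have h1 := (hl.pos i).ne'
  have h2 := Real.pi_pos.ne'
  have h3 : (k : ℝ) ≠ 0 := by exact_mod_cast hk
  have : 2 * Real.pi * k / l i ≠ 0 := by positivity
  simp_all

lemma analyticAt_kernel {A : Finset ι} {L : ℝ} {s : ℂ} (hs : s ≠ 0)
    (h : ∀ i ∈ A, 1 - Complex.exp (-(s * l i)) ≠ 0) : AnalyticAt ℂ (kernel l A L) s := by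
  unfold kernel
  refine AnalyticAt.div (by fun_prop) ?_ (mul_ne_zero hs (Finset.prod_ne_zero_iff.2 h))
  exact analyticAt_id.mul (Finset.analyticAt_fun_prod _ fun i _ => by fun_prop)

/-- With n = |A|, the kernel is the function of `ha` divided by s ^ (n + 1), so the residue is its
n-th Taylor coefficient. Since n ≤ 4, five coefficients suffice. -/
lemma kernel_principal_part_zero {A : Finset ι} {L : ℝ} {a : ℕ → ℂ} (hA : A.card ≤ 4)
    (ha : HasTaylor (fun s => Complex.exp (s * L)
      * ∏ i ∈ A, (s / (1 - Complex.exp (-(s * l i))))) a) :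
    ∃ g : ℂ → ℂ, AnalyticAt ℂ g 0 ∧ ∀ᶠ s in 𝓝[≠] (0 : ℂ), kernel l A L s
      = (∑ j ∈ Finset.range 5, (if j ≤ A.card then a (A.card - j) else 0)
          * (s ^ (j + 1))⁻¹) + g s := by
  obtain ⟨r, hr, h⟩ := ha
  have key : ∀ᶠ s in 𝓝[≠] (0 : ℂ), kernel l A L s
      = ((∑ j ∈ Finset.range 5, a j * s ^ j) + s ^ 5 * r s) * (s ^ (A.card + 1))⁻¹ := by
    filter_upwards [h, self_mem_nhdsWithin] with s hs hs0
    have hs0 : s ≠ 0 := hs0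
    rw [← hs, kernel, Finset.prod_div_distrib, Finset.prod_const, pow_succ]
    field_simp
  generalize A.card = n at *
  -- The Taylor terms of degree above n leave no pole after the division.
  refine ⟨fun s => (∑ j ∈ Finset.range 5, if n < j then a j * s ^ (j - (n + 1)) else 0)
    + s ^ (4 - n) * r s, ?_, ?_⟩
  · refine (Finset.analyticAt_fun_sum _ fun j _ => ?_).add (by fun_prop)
    split_ifs <;> fun_prop
  · filter_upwards [key, self_mem_nhdsWithin] with s hs hs0
    have hs0 : s ≠ 0 := hs0
    rw [hs]
    interval_cases n <;> simp [Finset.sum_range_succ] <;> field_simp <;> ring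

variable [DecidableEq ι]

/-- The residue of `kernel l A L` at `pole l i k` for `k ≠ 0`. -/
noncomputable def poleResidue (l : ι → ℝ) (A : Finset ι) (L : ℝ) (i : ι) (k : ℤ) : ℂ :=
  Complex.exp (pole l i k * L)
    / (pole l i k * l i * ∏ j ∈ A.erase i, (1 - Complex.exp (-(pole l i k * l j))))

/-- Only the i-th factor vanishes at this point, by incommensurability, and its zero is simple with
derivative l i. Dividing that zero out leaves an analytic H with kernel H(s)/(s - p); the residue is
H(p), and the slope of H is the regular part. -/
lemma kernel_principal_part_pole (hl : Incommensurable l) {A : Finset ι} {i : ι} (hi : i ∈ A)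
    (L : ℝ) {k : ℤ} (hk : k ≠ 0) : ∃ g : ℂ → ℂ, AnalyticAt ℂ g (pole l i k) ∧
      ∀ᶠ s in 𝓝[≠] (pole l i k),
        kernel l A L s = poleResidue l A L i k * (s - pole l i k)⁻¹ + g s := by
  set p := pole l i k with hp
  set v : ℂ → ℂ := fun s => 1 - Complex.exp (-(s * l i)) with hv
  have hv0 : v p = 0 := one_sub_exp_pole_same hl i k
  have hva : AnalyticAt ℂ v p := by rw [hv]; fun_prop
  set w : ℂ → ℂ := dslope v p with hw
  have hwa : AnalyticAt ℂ w p := hva.dslope_same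
  have hvd : HasDerivAt v (l i : ℂ) p := by
    have h1 : HasDerivAt (fun s : ℂ => -(s * l i)) (-(l i : ℂ)) p := by
      simpa using! ((hasDerivAt_id p).mul_const (l i : ℂ)).neg
    have h2 := (h1.cexp.const_sub 1)
    have h3 : Complex.exp (-(p * l i)) = 1 := by
      rw [← sub_eq_zero.1 hv0]
    rw [h3] at h2
    simpa using h2
  have hwp : w p = l i := by rw [hw, dslope_same, hvd.deriv]
  have hli : (l i : ℂ) ≠ 0 := by exact_mod_cast (hl.pos i).ne'
  have hp0 : p ≠ 0 := pole_ne_zero hl i hk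
  set H : ℂ → ℂ := fun s => Complex.exp (s * L)
    / (s * w s * ∏ j ∈ A.erase i, (1 - Complex.exp (-(s * l j)))) with hH
  have hprod : ∏ j ∈ A.erase i, (1 - Complex.exp (-(p * l j))) ≠ 0 :=
    Finset.prod_ne_zero_iff.2 fun j hj =>
      one_sub_exp_pole_ne_zero hl (Finset.ne_of_mem_erase hj).symm hk
  have hHa : AnalyticAt ℂ H p := by
    refine AnalyticAt.div (by fun_prop) ?_ (mul_ne_zero (mul_ne_zero hp0 (by rwa [hwp])) hprod)
    exact (analyticAt_id.mul hwa).mul (Finset.analyticAt_fun_prod _ fun i _ => by fun_prop)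
  have hHp : H p = poleResidue l A L i k := by
    rw [hH, poleResidue]
    simp only [hwp]
    rw [hp]
  refine ⟨dslope H p, hHa.dslope_same, ?_⟩
  filter_upwards [self_mem_nhdsWithin] with s hs
  have hs : s - p ≠ 0 := sub_ne_zero.2 hs
  have e1 : (s - p) * w s = v s := by
    have := sub_smul_dslope v p s
    rwa [hv0, sub_zero, smul_eq_mul] at this
  have e2 : (s - p) * dslope H p s = H s - H p := by
    simpa using sub_smul_dslope H p s
  have e3 : kernel l A L s = H s * (s - p)⁻¹ := by
    rw [kernel, hH, ← Finset.mul_prod_erase A _ hi]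
    change _ / (s * (v s * _)) = _
    rw [← e1, ← div_eq_mul_inv, div_div]
    congr 1
    ring
  rw [e3, ← hHp, show H s = H p + (s - p) * dslope H p s by rw [e2]; ring]
  field_simp

/-- The sum of the residues of the kernel at the nonzero poles of height less than `2 * π * R`. -/
noncomputable def residueSum (l : ι → ℝ) (A : Finset ι) (L R : ℝ) : ℂ :=
  ∑ i ∈ A, ∑ k ∈ Finset.Icc 1 ⌊R * l i⌋₊,
    (poleResidue l A L i k + poleResidue l A L i (-(k : ℤ)))

/-- All poles are on the imaginary axis, so the right-hand side does not depend on U; this is what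
later allows U → ∞ with R fixed. The hypothesis `hRn` keeps the poles off the boundary. -/
theorem rectInt_kernel (hl : Incommensurable l) {A : Finset ι} (hA : A.card ≤ 4) {L : ℝ}
    {a : ℕ → ℂ} (ha : HasTaylor (fun s => Complex.exp (s * L)
      * ∏ i ∈ A, (s / (1 - Complex.exp (-(s * l i))))) a) {U R : ℝ} (hU : 0 < U) (hR : 0 < R)
    (hRn : ∀ i, ∀ n : ℤ, R * l i ≠ n) :
    rectInt (kernel l A L) U (2 * Real.pi * R)
      = 2 * Real.pi * Complex.I * (a A.card + residueSum l A L R) := by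
  have hpi := Real.pi_pos
  set K : ι → Finset ℤ := fun i => (Finset.Icc (-(⌊R * l i⌋₊ : ℤ)) ⌊R * l i⌋₊).erase 0 with hK
  have hKmem : ∀ i k, k ∈ K i ↔ k ≠ 0 ∧ |(k : ℝ)| < R * l i := by
    intro i k
    have h0 : 0 ≤ R * l i := (mul_pos hR (hl.pos i)).le
    have h1 := Nat.floor_le h0
    rw [hK]
    simp only [Finset.mem_erase, Finset.mem_Icc, ← abs_le]
    refine and_congr_right fun _ => ⟨fun h => ?_, fun h => ?_⟩
    · have h2 : |(k : ℝ)| ≤ ⌊R * l i⌋₊ := by exact_mod_cast h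
      refine lt_of_le_of_ne (h2.trans h1) fun h3 => hRn i |k| ?_
      rw [← h3]; push_cast; rfl
    · have h2 : (k.natAbs : ℝ) ≤ R * l i := by
        rw [Nat.cast_natAbs]; push_cast; exact h.le
      have := Nat.le_floor h2
      rw [Int.abs_eq_natAbs]
      exact_mod_cast this
  -- `none` stands for the pole at 0, which is common to all factors and must be counted only once.
  set pt : Option (Σ _ : ι, ℤ) → ℂ := fun o => o.elim 0 fun q => pole l q.1 q.2 with hpt
  set S := Finset.insertNone (A.sigma K) with hS
  set c : Option (Σ _ : ι, ℤ) → ℕ → ℂ := fun o j => o.elim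
    (if j ≤ A.card then a (A.card - j) else 0)
    fun q => if j = 0 then poleResidue l A L q.1 q.2 else 0 with hc
  have hmem : ∀ q : (Σ _ : ι, ℤ), some q ∈ S ↔ q.1 ∈ A ∧ q.2 ∈ K q.1 := by
    intro q
    rw [hS, Finset.some_mem_insertNone, Finset.mem_sigma]
  have hmain := rectInt_eq_sum_residues_of_injOn (U := U) (T := 2 * Real.pi * R)
    (f := kernel l A L) S pt 4 c ?_ hU.le (by positivity) ?_ ?_ ?_
  · rw [hmain, hS, Finset.sum_insertNone, Finset.sum_sigma]
    congr 2
    refine Finset.sum_congr rfl fun i _ => ?_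
    rw [hK, ← sum_Icc_int_erase_zero]
    rfl
  · rintro (_ | ⟨i, k⟩) h1 (_ | ⟨j, m⟩) h2 h
    · rfl
    · exact absurd h.symm (pole_ne_zero hl j ((hKmem _ _).1 ((hmem _).1 h2).2).1)
    · exact absurd h (pole_ne_zero hl i ((hKmem _ _).1 ((hmem _).1 h1).2).1)
    · have h3 := (pole_eq_pole_iff hl i j k m).1 h
      have hk := ((hKmem _ _).1 ((hmem _).1 h1).2).1
      by_cases hij : i = j
      · subst hij
        have := mul_right_cancel₀ (hl.pos i).ne' h3
        norm_cast at this
        subst this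
        rfl
      · exact absurd h3 (hl.ne i j hij k m hk)
  · rintro (_ | ⟨i, k⟩) h
    · simp only [hpt, Option.elim, Complex.zero_re, Complex.zero_im, abs_zero]
      exact ⟨hU, by positivity⟩
    · have h1 := ((hKmem _ _).1 ((hmem _).1 h).2).2
      have h2 := hl.pos i
      simp only [hpt, Option.elim, pole_re, pole_im, abs_zero]
      refine ⟨hU, ?_⟩
      rw [abs_div, abs_mul, abs_of_pos h2, abs_of_pos (by positivity : 0 < 2 * Real.pi),
        div_lt_iff₀ h2, mul_assoc (2 * Real.pi) R]
      exact mul_lt_mul_of_pos_left h1 (by positivity)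
  · intro s _ hs hne
    have hs0 : s ≠ 0 := hne none (by simp [hS])
    refine (analyticAt_kernel hs0 fun i hi h0 => ?_).differentiableAt
    obtain ⟨k, hk⟩ := (one_sub_exp_eq_zero_iff (hl.pos i).ne' s).1 h0
    have hk : s = pole l i k := hk
    have hk0 : k ≠ 0 := by
      rintro rfl
      exact hs0 (by rw [hk]; simp [pole])
    refine hne (some ⟨i, k⟩) ((hmem _).2 ⟨hi, (hKmem _ _).2 ⟨hk0, ?_⟩⟩) hk
    have h2 := hl.pos i
    rw [hk, pole_im, abs_div, abs_mul, abs_of_pos h2,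
      abs_of_pos (by positivity : 0 < 2 * Real.pi), div_le_iff₀ h2, mul_assoc (2 * Real.pi) R] at hs
    have h3 := le_of_mul_le_mul_left hs (by positivity)
    refine lt_of_le_of_ne h3 fun h4 => hRn i |k| ?_
    rw [← h4]; push_cast; rfl
  · rintro (_ | ⟨i, k⟩) h
    · obtain ⟨g, hg, h⟩ := kernel_principal_part_zero hA ha
      refine ⟨g, hg, ?_⟩
      simpa [hpt, hc] using h
    · obtain ⟨hi, hk⟩ := (hmem _).1 h
      obtain ⟨g, hg, h⟩ := kernel_principal_part_pole hl hi L ((hKmem _ _).1 hk).1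
      refine ⟨g, hg, h.mono fun s hs => ?_⟩
      rw [hs]
      simp [hpt, hc]

end kernel

/-! ### Vanishing of the boundary integrals for arguments left of the origin -/

/-- On the horizontal sides e^{-s l_i} has argument ±2πR l_i, so this keeps it out of a sector
around the positive real axis. The cap 1/4 keeps the bound nonnegative, as needed for the constant ρ
below. -/
lemma cos_two_pi_mul_le {δ t : ℝ} (hδ : 0 < δ) (h : ∀ n : ℤ, δ ≤ |t - n|) :
    Real.cos (2 * Real.pi * t) ≤ Real.cos (2 * Real.pi * min δ (1 / 4)) := by
  have hpi := Real.pi_pos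
  have h1 : Real.cos (2 * Real.pi * t) = Real.cos (2 * Real.pi * |t - round t|) := by
    rw [← Real.cos_sub_int_mul_two_pi _ (round t), ← Real.cos_abs]
    congr 1
    rw [show 2 * Real.pi * t - round t * (2 * Real.pi) = 2 * Real.pi * (t - round t) by ring,
      abs_mul, abs_of_pos (by positivity : 0 < 2 * Real.pi)]
  rw [h1]
  have h2 := abs_sub_round t
  have h3 : min δ (1 / 4) ≤ |t - round t| := (min_le_left _ _).trans (h _)
  have h4 : 0 < min δ (1 / 4) := by positivity
  refine Real.cos_le_cos_of_nonneg_of_le_pi (by positivity) ?_ ?_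
  · nlinarith
  · exact mul_le_mul_of_nonneg_left h3 (by positivity)

/-- Both bounds follow from |1 - z|² = 1 + |z|² - 2 Re z ≥ (1 - ρ)(1 + |z|²), the inequality being
ρ(1 - |z|)² ≥ 0. -/
lemma one_sub_le_norm_one_sub {z : ℂ} {ρ : ℝ} (h0 : 0 ≤ ρ) (h1 : ρ < 1)
    (h : z.re ≤ ρ * ‖z‖) : 1 - ρ ≤ ‖1 - z‖ ∧ (1 - ρ) * ‖z‖ ≤ ‖1 - z‖ := by
  have hz := norm_nonneg z
  have e : ‖1 - z‖ ^ 2 = 1 + ‖z‖ ^ 2 - 2 * z.re := by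
    rw [← Complex.normSq_eq_norm_sq, ← Complex.normSq_eq_norm_sq, Complex.normSq_apply,
      Complex.normSq_apply]
    simp only [Complex.sub_re, Complex.one_re, Complex.sub_im, Complex.one_im]
    ring
  have k : (1 - ρ) * (1 + ‖z‖ ^ 2) ≤ ‖1 - z‖ ^ 2 := by
    rw [e]
    nlinarith [mul_nonneg h0 (sq_nonneg (1 - ‖z‖))]
  have hρ : 0 ≤ ρ * (1 - ρ) := mul_nonneg h0 (by linarith)
  constructor
  · refine abs_le_of_sq_le_sq' ?_ (norm_nonneg _) |>.2
    nlinarith [mul_nonneg (sub_nonneg.2 h1.le) (sq_nonneg ‖z‖)]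
  · refine abs_le_of_sq_le_sq' ?_ (norm_nonneg _) |>.2
    nlinarith [mul_nonneg hρ (sq_nonneg ‖z‖)]

lemma half_le_norm_one_sub {z : ℂ} (h : ‖z‖ ≤ 1 / 2 ∨ 2 ≤ ‖z‖) :
    1 / 2 ≤ ‖1 - z‖ ∧ 1 / 2 * ‖z‖ ≤ ‖1 - z‖ := by
  have h1 := norm_sub_norm_le 1 z
  have h2 := norm_sub_norm_le z 1
  rw [norm_sub_rev z 1] at h2
  rw [norm_one] at h1 h2
  rcases h with h | h <;> constructor <;> linarith

section bounds

variable {ι : Type*} {l : ι → ℝ}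

lemma norm_exp_neg_mul (s : ℂ) (a : ℝ) :
    ‖Complex.exp (-(s * a))‖ = Real.exp (-(s.re * a)) := by
  rw [Complex.norm_exp, Complex.neg_re, Complex.re_mul_ofReal]

/-- For Re s ≥ 0 the bound c on each factor leaves e^{L Re s}; for Re s ≤ 0 the bound c|e^{-s l_i}|
leaves e^{(L + ∑ l_i) Re s}. When -∑ l_i < L < 0 a positive η is available, and the kernel decays on
both sides. -/
lemma norm_kernel_le {A : Finset ι} {L c η : ℝ} {s : ℂ} (hc : 0 < c) (hη : η ≤ -L)
    (hη' : η ≤ L + ∑ i ∈ A, l i)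
    (h : ∀ i ∈ A, c ≤ ‖1 - Complex.exp (-(s * l i))‖ ∧
      c * ‖Complex.exp (-(s * l i))‖ ≤ ‖1 - Complex.exp (-(s * l i))‖) :
    ‖kernel l A L s‖ ≤ Real.exp (-(η * |s.re|)) * ((c ^ A.card)⁻¹ * ‖s‖⁻¹) := by
  have h1 : c ^ A.card ≤ ∏ i ∈ A, ‖1 - Complex.exp (-(s * l i))‖ := by
    rw [← Finset.prod_const]
    exact Finset.prod_le_prod (fun _ _ => hc.le) fun i hi => (h i hi).1
  have h2 : c ^ A.card * Real.exp (-(s.re * ∑ i ∈ A, l i))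
      ≤ ∏ i ∈ A, ‖1 - Complex.exp (-(s * l i))‖ := by
    rw [Finset.mul_sum, ← Finset.sum_neg_distrib, Real.exp_sum, ← Finset.prod_const,
      ← Finset.prod_mul_distrib]
    refine Finset.prod_le_prod (fun _ _ => by positivity) fun i hi => ?_
    rw [← norm_exp_neg_mul]
    exact (h i hi).2
  have hcn : 0 < c ^ A.card := by positivity
  have hpos : 0 < ∏ i ∈ A, ‖1 - Complex.exp (-(s * l i))‖ := hcn.trans_le h1
  rw [kernel, norm_div, norm_mul, norm_prod, Complex.norm_exp, Complex.re_mul_ofReal,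
    div_eq_mul_inv, mul_inv, mul_comm ‖s‖⁻¹, ← mul_assoc, ← mul_assoc]
  refine mul_le_mul_of_nonneg_right ?_ (by positivity)
  rw [← div_eq_mul_inv, ← div_eq_mul_inv, div_le_div_iff₀ hpos hcn]
  rcases le_total 0 s.re with hs | hs
  · refine mul_le_mul (Real.exp_le_exp.2 ?_) h1 hcn.le (Real.exp_pos _).le
    rw [abs_of_nonneg hs]
    nlinarith
  · refine le_trans ?_ (mul_le_mul_of_nonneg_left h2 (Real.exp_pos _).le)
    rw [mul_left_comm, ← Real.exp_add, mul_comm _ (c ^ A.card)]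
    refine mul_le_mul_of_nonneg_left (Real.exp_le_exp.2 ?_) hcn.le
    rw [abs_of_nonpos hs]
    nlinarith

lemma exp_neg_abs_le (y : ℝ) : Real.exp (-|y|) ≤ 2 * (1 + y ^ 2)⁻¹ := by
  have h := Real.quadratic_le_exp_of_nonneg (abs_nonneg y)
  have h2 := sq_abs y
  have h3 := abs_nonneg y
  rw [Real.exp_neg, ← div_eq_mul_inv, inv_le_comm₀ (Real.exp_pos _) (by positivity), inv_div]
  nlinarith

/-- The point is that M does not depend on U, so the bound on the horizontal sides survives U → ∞.
-/
lemma integral_exp_neg_abs_le {η : ℝ} (hη : 0 < η) : ∃ M : ℝ, ∀ U : ℝ, 0 ≤ U →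
    ∫ x in (-U)..U, Real.exp (-(η * |x|)) ≤ M := by
  have hint : MeasureTheory.Integrable fun x : ℝ => 2 * (1 + (η * x) ^ 2)⁻¹ :=
    (integrable_inv_one_add_sq.comp_mul_left' hη.ne').const_mul 2
  refine ⟨∫ x : ℝ, 2 * (1 + (η * x) ^ 2)⁻¹, fun U hU => ?_⟩
  calc ∫ x in (-U)..U, Real.exp (-(η * |x|))
      ≤ ∫ x in (-U)..U, 2 * (1 + (η * x) ^ 2)⁻¹ := by
        refine intervalIntegral.integral_mono (by linarith)
          (Continuous.intervalIntegrable (by fun_prop) _ _) hint.intervalIntegrable fun x => ?_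
        have := exp_neg_abs_le (η * x)
        rwa [abs_mul, abs_of_pos hη] at this
    _ ≤ _ := by
        rw [intervalIntegral.integral_of_le (by linarith)]
        exact MeasureTheory.setIntegral_le_integral hint
          (Eventually.of_forall fun x => by positivity)

lemma norm_rectInt_le {f : ℂ → ℂ} {U T η a b M : ℝ} (hU : 0 ≤ U) (hT : 0 ≤ T)
    (hM : ∫ x in (-U)..U, Real.exp (-(η * |x|)) ≤ M) (ha : 0 ≤ a)
    (hor : ∀ x t : ℝ, |t| = T → ‖f (x + (t : ℂ) * Complex.I)‖ ≤ Real.exp (-(η * |x|)) * a)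
    (ver : ∀ u y : ℝ, |u| = U → ‖f (u + (y : ℂ) * Complex.I)‖ ≤ b) :
    ‖rectInt f U T‖ ≤ 2 * (M * a) + 2 * (b * (2 * T)) := by
  have hT' : |(-T)| = T := by rw [abs_neg, abs_of_nonneg hT]
  have hU' : |(-U)| = U := by rw [abs_neg, abs_of_nonneg hU]
  have h1 : ∀ t : ℝ, |t| = T →
      ‖∫ x : ℝ in (-U)..U, f (x + (t : ℂ) * Complex.I)‖ ≤ M * a := by
    intro t ht
    refine (intervalIntegral.norm_integral_le_of_norm_le (by linarith)
      (Eventually.of_forall fun x _ => hor x t ht)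
      (Continuous.intervalIntegrable (by fun_prop) _ _)).trans ?_
    rw [intervalIntegral.integral_mul_const]
    exact mul_le_mul_of_nonneg_right hM ha
  have h2 : ∀ u : ℝ, |u| = U →
      ‖Complex.I * ∫ y : ℝ in (-T)..T, f (u + (y : ℂ) * Complex.I)‖ ≤ b * (2 * T) := by
    intro u hu
    rw [norm_mul, Complex.norm_I, one_mul]
    refine (intervalIntegral.norm_integral_le_of_norm_le_const fun y _ => ver u y hu).trans ?_
    rw [show T - -T = 2 * T by ring, abs_of_nonneg (by positivity)]
  unfold rectInt
  refine (norm_sub_le _ _).trans ?_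
  refine (add_le_add_left ((norm_add_le _ _).trans (add_le_add_left (norm_sub_le _ _) _)) _).trans ?_
  have := h1 _ hT'
  have := h1 _ (abs_of_nonneg hT)
  have := h2 _ hU'
  have := h2 _ (abs_of_nonneg hU)
  linarith

end bounds

section limits

variable {ι : Type*} {l : ι → ℝ}

lemma exists_hasTaylor_kernel (hl : Incommensurable l) (A : Finset ι) (L : ℝ) :
    ∃ a, HasTaylor (fun s => Complex.exp (s * L)
      * ∏ i ∈ A, (s / (1 - Complex.exp (-(s * l i))))) a := by
  obtain ⟨b, hb⟩ := hasTaylor_prod_exists A fun i _ =>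
    ⟨_, hasTaylor_todd (l := (l i : ℂ)) (by exact_mod_cast (hl.pos i).ne')⟩
  exact ⟨_, (hasTaylor_exp (L : ℂ)).mul hb⟩

/-- The filter `F` consists of `R → ∞` that keep all `R * l i` away from the integers. -/
structure AvoidsPoles (l : ι → ℝ) (F : Filter ℝ) (δ : ℝ) : Prop where
  le_atTop : F ≤ atTop
  pos : 0 < δ
  dist : ∀ᶠ R in F, ∀ i, ∀ n : ℤ, δ ≤ |R * l i - n|

lemma AvoidsPoles.ne {F : Filter ℝ} {δ : ℝ} (hF : AvoidsPoles l F δ) :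
    ∀ᶠ R in F, 0 < R ∧ (∀ i, ∀ n : ℤ, R * l i ≠ n) ∧ ∀ i, ∀ n : ℤ, δ ≤ |R * l i - n| := by
  filter_upwards [hF.dist, hF.le_atTop (eventually_gt_atTop 0)] with R h1 h2
  refine ⟨h2, fun i n h => ?_, h1⟩
  have := h1 i n
  rw [h, sub_self, abs_zero] at this
  exact this.not_gt hF.pos

/-- For fixed R the half-width 1 may be replaced by any U. As U → ∞ the vertical sides vanish, and
the horizontal ones stay below a constant over R; only then does R → ∞. -/
theorem tendsto_rectInt_kernel_zero [DecidableEq ι] (hl : Incommensurable l) {F : Filter ℝ} {δ : ℝ}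
    (hF : AvoidsPoles l F δ) {A : Finset ι} (hA : A.card ≤ 4) {L : ℝ} (hL : L < 0)
    (hL' : -∑ i ∈ A, l i < L) :
    Tendsto (fun R => rectInt (kernel l A L) 1 (2 * Real.pi * R)) F (𝓝 0) := by
  have hpi := Real.pi_pos
  set η := min (-L) (L + ∑ i ∈ A, l i) with hη
  have hη0 : 0 < η := lt_min (by linarith) (by linarith)
  obtain ⟨M, hM⟩ := integral_exp_neg_abs_le hη0
  set ρ := Real.cos (2 * Real.pi * min δ (1 / 4)) with hρ
  have hd : 0 < min δ (1 / 4) := lt_min hF.pos (by norm_num)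
  have hd' : min δ (1 / 4) ≤ 1 / 4 := min_le_right _ _
  have hρ0 : 0 ≤ ρ := Real.cos_nonneg_of_neg_pi_div_two_le_of_le (by nlinarith) (by nlinarith)
  have hρ1 : ρ < 1 := by
    have := Real.cos_lt_cos_of_nonneg_of_le_pi_div_two (x := 0)
      (y := 2 * Real.pi * min δ (1 / 4)) le_rfl (by nlinarith) (by positivity)
    rwa [Real.cos_zero] at this
  obtain ⟨a, ha⟩ := exists_hasTaylor_kernel hl A L
  set C := ((1 - ρ) ^ A.card)⁻¹ with hC
  have hC0 : 0 ≤ C := by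
    have : 0 < 1 - ρ := by linarith
    positivity
  have key : ∀ᶠ R in F, ‖rectInt (kernel l A L) 1 (2 * Real.pi * R)‖
      ≤ 2 * (M * (C * (2 * Real.pi * R)⁻¹)) := by
    filter_upwards [hF.ne] with R hR
    obtain ⟨hR0, hRn, hRd⟩ := hR
    have hT : 0 < 2 * Real.pi * R := by positivity
    -- From here on e^{-s l_i} has modulus at most 1/2 or at least 2 on the vertical sides.
    have hbig : ∀ᶠ U : ℝ in atTop, ∀ i ∈ A, Real.log 2 ≤ U * l i := by
      rw [Filter.eventually_all_finset]
      intro i _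
      filter_upwards [eventually_ge_atTop (Real.log 2 / l i)] with U hU
      rwa [div_le_iff₀ (hl.pos i)] at hU
    have hlim : Tendsto (fun U : ℝ => 2 * (M * (C * (2 * Real.pi * R)⁻¹))
        + 2 * (Real.exp (-(η * U)) * (((1 / 2 : ℝ) ^ A.card)⁻¹ * U⁻¹)
          * (2 * (2 * Real.pi * R)))) atTop (𝓝 (2 * (M * (C * (2 * Real.pi * R)⁻¹))
        + 2 * (0 * (((1 / 2 : ℝ) ^ A.card)⁻¹ * 0) * (2 * (2 * Real.pi * R))))) := by
      refine tendsto_const_nhds.add ((Tendsto.mul_const _ (Tendsto.mul ?_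
        (tendsto_inv_atTop_zero.const_mul _))).const_mul _)
      exact Real.tendsto_exp_neg_atTop_nhds_zero.comp (tendsto_id.const_mul_atTop hη0)
    have hle := ge_of_tendsto (b := ‖rectInt (kernel l A L) 1 (2 * Real.pi * R)‖) hlim ?_
    · simpa using hle
    · filter_upwards [hbig, eventually_gt_atTop 0] with U hU hU0
      -- Both half-widths enclose the same poles, so the integrals agree through the residue
      -- formula.
      rw [rectInt_kernel hl hA ha one_pos hR0 hRn, ← rectInt_kernel hl hA ha hU0 hR0 hRn]
      refine norm_rectInt_le hU0.le hT.le (hM U hU0.le) (by positivity) ?_ ?_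
      · intro x t ht
        set s : ℂ := x + (t : ℂ) * Complex.I with hs
        have hre : s.re = x := by simp [hs]
        have him : s.im = t := by simp [hs]
        have h1 := norm_kernel_le (l := l) (A := A) (L := L) (s := s)
          (sub_pos.2 hρ1) (min_le_left _ _ : η ≤ -L) (min_le_right _ _) fun i _ => by
            refine one_sub_le_norm_one_sub hρ0 hρ1 ?_
            rw [Complex.exp_re, Complex.norm_exp, mul_comm]
            refine mul_le_mul_of_nonneg_right ?_ (Real.exp_pos _).le
            have : Real.cos (-(s * l i)).im = Real.cos (2 * Real.pi * (R * l i)) := by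
              rw [Complex.neg_im, Complex.im_mul_ofReal, Real.cos_neg, him, ← Real.cos_abs,
                abs_mul, ht, abs_of_pos (hl.pos i), mul_assoc]
            rw [this]
            exact cos_two_pi_mul_le hF.pos (hRd i)
        rw [hre] at h1
        refine h1.trans (mul_le_mul_of_nonneg_left (mul_le_mul_of_nonneg_left ?_ hC0)
          (Real.exp_pos _).le)
        refine inv_anti₀ hT ?_
        rw [← ht, ← him]
        exact Complex.abs_im_le_norm s
      · intro u y hu
        set s : ℂ := u + (y : ℂ) * Complex.I with hs
        have hre : s.re = u := by simp [hs]
        have h1 := norm_kernel_le (l := l) (A := A) (L := L) (s := s)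
          (by norm_num : (0 : ℝ) < 1 / 2) (min_le_left _ _ : η ≤ -L) (min_le_right _ _)
          fun i hi => by
            refine half_le_norm_one_sub ?_
            rw [norm_exp_neg_mul, hre]
            have h2 := hU i hi
            have h3 := Real.exp_le_exp.2 h2
            rw [Real.exp_log two_pos] at h3
            rcases abs_choice u with h | h
            · left
              rw [← h, hu, Real.exp_neg, one_div]
              exact inv_anti₀ two_pos h3
            · right
              rw [show -(u * l i) = |u| * l i by rw [h]; ring, hu]
              exact h3
        rw [hre, hu] at h1
        refine h1.trans (mul_le_mul_of_nonneg_left (mul_le_mul_of_nonneg_left ?_ (by positivity))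
          (Real.exp_pos _).le)
        refine inv_anti₀ hU0 ?_
        rw [← hu, ← hre]
        exact Complex.abs_re_le_norm s
  refine squeeze_zero_norm' key ?_
  have h1 : Tendsto (fun R : ℝ => 2 * (M * (C * (2 * Real.pi * R)⁻¹))) atTop
      (𝓝 (2 * (M * (C * 0)))) :=
    (((tendsto_inv_atTop_zero.comp (tendsto_id.const_mul_atTop
      (by positivity : 0 < 2 * Real.pi))).const_mul _).const_mul _).const_mul _
  simp only [mul_zero] at h1
  exact h1.mono_left hF.le_atTop

end limits

/-! ### The boundary integrals count lattice points -/

section recursion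

variable {ι : Type*} {l : ι → ℝ}

lemma ne_zero_of_mem_rectBoundary (hl : Incommensurable l) {R : ℝ} (hR : 0 < R)
    (hRn : ∀ i, ∀ n : ℤ, R * l i ≠ n) {s : ℂ} (hs : s ∈ rectBoundary 1 (2 * Real.pi * R)) :
    s ≠ 0 ∧ ∀ i, 1 - Complex.exp (-(s * l i)) ≠ 0 := by
  have hpi := Real.pi_pos
  constructor
  · rintro rfl
    rcases hs.2.2 with h | h
    · simp at h
    · simp only [Complex.zero_im, abs_zero] at h
      have : 0 < 2 * Real.pi * R := by positivity
      linarith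
  · intro i h
    obtain ⟨k, hk⟩ := (one_sub_exp_eq_zero_iff (hl.pos i).ne' s).1 h
    have hk : s = pole l i k := hk
    have h2 := hl.pos i
    rcases hs.2.2 with h | h
    · rw [hk, pole_re] at h
      simp at h
    · rw [hk, pole_im, abs_div, abs_mul, abs_of_pos h2,
        abs_of_pos (by positivity : 0 < 2 * Real.pi), div_eq_iff h2.ne',
        mul_assoc (2 * Real.pi) R] at h
      have h3 := mul_left_cancel₀ (by positivity : 2 * Real.pi ≠ 0) h
      refine hRn i |k| ?_
      rw [← h3]; push_cast; rfl

lemma continuousOn_kernel (hl : Incommensurable l) (A : Finset ι) (L : ℝ) {R : ℝ} (hR : 0 < R)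
    (hRn : ∀ i, ∀ n : ℤ, R * l i ≠ n) :
    ContinuousOn (kernel l A L) (rectBoundary 1 (2 * Real.pi * R)) := fun _ hs =>
  have h := ne_zero_of_mem_rectBoundary hl hR hRn hs
  (analyticAt_kernel h.1 fun i _ => h.2 i).continuousAt.continuousWithinAt

/-- The difference e^{sL} - e^{s(L - l_b)} equals e^{sL}(1 - e^{-s l_b}), which cancels the factor
of b. For the counts: either b is not used, or one copy of it is removed. -/
lemma kernel_insert [DecidableEq ι] {A : Finset ι} {b : ι} (hb : b ∉ A) (L : ℝ) {s : ℂ}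
    (h : 1 - Complex.exp (-(s * l b)) ≠ 0) :
    kernel l (insert b A) L s = kernel l (insert b A) (L - l b) s + kernel l A L s := by
  simp only [kernel, Finset.prod_insert hb]
  rw [show s * ((L - l b : ℝ) : ℂ) = s * L + -(s * l b) by push_cast; ring, Complex.exp_add]
  generalize Complex.exp (-(s * l b)) = z at *
  rw [← mul_div_mul_right (Complex.exp (s * L)) (s * ∏ i ∈ A, _) h, mul_assoc s,
    mul_comm (∏ i ∈ A, _) (1 - z), ← add_div]
  congr 1
  ring

lemma hasTaylor_empty (L : ℝ) : HasTaylor (fun s => Complex.exp (s * L)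
    * ∏ i ∈ (∅ : Finset ι), (s / (1 - Complex.exp (-(s * l i)))))
    (fun j => (L : ℂ) ^ j / (j.factorial : ℂ)) :=
  (hasTaylor_exp (L : ℂ)).congr fun s => by simp

/-- The normalized boundary integrals of `kernel l A L` tend to `v` along `F`. -/
def HasCount (l : ι → ℝ) (F : Filter ℝ) (A : Finset ι) (L v : ℝ) : Prop :=
  Tendsto (fun R => rectInt (kernel l A L) 1 (2 * Real.pi * R)) F
    (𝓝 (2 * Real.pi * Complex.I * v))

variable [DecidableEq ι] {F : Filter ℝ} {δ : ℝ}

lemma HasCount.insert_of_sub (hl : Incommensurable l) (hF : AvoidsPoles l F δ) {A : Finset ι}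
    {b : ι} (hb : b ∉ A) {L v w : ℝ} (h1 : HasCount l F (insert b A) (L - l b) v)
    (h2 : HasCount l F A L w) : HasCount l F (insert b A) L (w + v) := by
  unfold HasCount at *
  have h := h1.add h2
  have e : 2 * (Real.pi : ℂ) * Complex.I * v + 2 * Real.pi * Complex.I * w
      = 2 * Real.pi * Complex.I * ((w + v : ℝ) : ℂ) := by push_cast; ring
  rw [e] at h
  refine h.congr' ?_
  filter_upwards [hF.ne] with R hR
  obtain ⟨hR0, hRn, -⟩ := hR
  have hT : 0 ≤ 2 * Real.pi * R := by positivity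
  rw [← rectInt_add zero_le_one hT (continuousOn_kernel hl _ _ hR0 hRn)
    (continuousOn_kernel hl _ _ hR0 hRn)]
  refine rectInt_congr zero_le_one hT fun s hs => ?_
  exact (kernel_insert hb L ((ne_zero_of_mem_rectBoundary hl hR0 hRn hs).2 b)).symm

lemma HasCount.insert_of_sub_mul (hl : Incommensurable l) (hF : AvoidsPoles l F δ)
    {A : Finset ι} {b : ι} (hb : b ∉ A) (m : ℕ) {L v : ℝ} {w : ℕ → ℝ}
    (h1 : HasCount l F (insert b A) (L - m * l b) v)
    (h2 : ∀ j < m, HasCount l F A (L - j * l b) (w j)) :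
    HasCount l F (insert b A) L ((∑ j ∈ Finset.range m, w j) + v) := by
  induction m generalizing v with
  | zero => simpa using h1
  | succ m ih =>
    have h3 : HasCount l F (insert b A) (L - m * l b) (w m + v) := by
      refine HasCount.insert_of_sub hl hF hb ?_ (h2 m (Nat.lt_succ_self m))
      convert h1 using 1
      push_cast
      ring
    rw [Finset.sum_range_succ, add_assoc]
    exact ih h3 fun j hj => h2 j (hj.trans (Nat.lt_succ_self m))

lemma hasCount_zero (hl : Incommensurable l) (hF : AvoidsPoles l F δ) {A : Finset ι}
    (hA : A.card ≤ 4) {L : ℝ} (hL : L < 0) (hL' : -∑ i ∈ A, l i < L) : HasCount l F A L 0 := by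
  simpa [HasCount] using tendsto_rectInt_kernel_zero hl hF hA hL hL'

/-- The convergence of the boundary integrals as convergence of sums of residues. -/
lemma HasCount.tendsto_residueSum (hl : Incommensurable l) (hF : AvoidsPoles l F δ)
    {A : Finset ι} (hA : A.card ≤ 4) {L v : ℝ} (h : HasCount l F A L v) {a : ℕ → ℂ}
    (ha : HasTaylor (fun s => Complex.exp (s * L)
      * ∏ i ∈ A, (s / (1 - Complex.exp (-(s * l i))))) a) :
    Tendsto (residueSum l A L) F (𝓝 (v - a A.card)) := by
  have h1 := (h.const_mul (2 * Real.pi * Complex.I)⁻¹).sub_const (a A.card)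
  rw [inv_mul_cancel_left₀ Complex.two_pi_I_ne_zero] at h1
  refine h1.congr' ?_
  filter_upwards [hF.ne] with R hR
  rw [rectInt_kernel hl hA ha one_pos hR.1 hR.2.1, inv_mul_cancel_left₀ Complex.two_pi_I_ne_zero]
  ring

lemma hasCount_of_tendsto_residueSum (hl : Incommensurable l) (hF : AvoidsPoles l F δ)
    {A : Finset ι} (hA : A.card ≤ 4) {L v : ℝ} {a : ℕ → ℂ}
    (ha : HasTaylor (fun s => Complex.exp (s * L)
      * ∏ i ∈ A, (s / (1 - Complex.exp (-(s * l i))))) a)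
    (h : Tendsto (residueSum l A L) F (𝓝 (v - a A.card))) : HasCount l F A L v := by
  have h1 := (h.const_add (a A.card)).const_mul (2 * Real.pi * Complex.I)
  rw [add_sub_cancel] at h1
  refine h1.congr' ?_
  filter_upwards [hF.ne] with R hR
  rw [rectInt_kernel hl hA ha one_pos hR.1 hR.2.1]

lemma HasTaylor.insert (hl : Incommensurable l) {A : Finset ι} {b : ι} (hb : b ∉ A)
    {L : ℝ} {a : ℕ → ℂ} (ha : HasTaylor (fun s => Complex.exp (s * L)
      * ∏ i ∈ A, (s / (1 - Complex.exp (-(s * l i))))) a) :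
    HasTaylor (fun s => Complex.exp (s * L)
      * ∏ i ∈ insert b A, (s / (1 - Complex.exp (-(s * l i)))))
      (fun n => ∑ i ∈ Finset.range (n + 1), a i * toddCoeff (l b) (n - i)) :=
  (ha.mul (hasTaylor_todd (by exact_mod_cast (hl.pos b).ne'))).congr fun s => by
    rw [Finset.prod_insert hb]; ring

lemma hasTaylor_singleton (hl : Incommensurable l) (b : ι) (L : ℝ) : ∃ a : ℕ → ℂ,
    a 1 = ((L / l b + 1 / 2 : ℝ) : ℂ) ∧ HasTaylor (fun s => Complex.exp (s * L)
      * ∏ i ∈ {b}, (s / (1 - Complex.exp (-(s * l i))))) a := by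
  refine ⟨_, ?_, HasTaylor.insert hl (Finset.notMem_empty b) (hasTaylor_empty L)⟩
  simp [Finset.sum_range_succ, toddCoeff]
  ring

/-- The only pole is 0, with residue 1 whatever the sign of L. The empty set therefore does not
detect L < 0, and the recursion has to start from singletons. -/
lemma hasCount_empty (hl : Incommensurable l) (hF : AvoidsPoles l F δ) (L : ℝ) :
    HasCount l F ∅ L 1 :=
  hasCount_of_tendsto_residueSum hl hF (by simp) (hasTaylor_empty L) (by
    have : residueSum l ∅ L = fun _ => 0 := by funext R; simp [residueSum]
    rw [this]
    simp only [Finset.card_empty, pow_zero, Nat.factorial_zero, Nat.cast_one, div_one,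
      Complex.ofReal_one, sub_self]
    exact tendsto_const_nhds)

/-- At L = 0 the residues at ±k cancel, and the residue at 0 is 1/2. This is where the weight 1/2 on
the boundary comes from. -/
lemma hasCount_singleton_zero (hl : Incommensurable l) (hF : AvoidsPoles l F δ) (b : ι) :
    HasCount l F {b} 0 (1 / 2) := by
  obtain ⟨a, ha, h⟩ := hasTaylor_singleton hl b 0
  refine hasCount_of_tendsto_residueSum hl hF (by simp) h ?_
  rw [Finset.card_singleton, ha]
  have : residueSum l {b} 0 = fun _ => 0 := by
    funext R
    have hp : ∀ k : ℤ, pole l b (-k) = -pole l b k := fun k => by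
      simp only [pole]; push_cast; ring
    simp [residueSum, poleResidue, hp]
  rw [this, zero_div, zero_add, sub_self]
  exact tendsto_const_nhds

/-- The weight of a lattice point at signed distance `t` from the boundary. -/
noncomputable def halfStep (t : ℝ) : ℝ := if t < 0 then 0 else if t = 0 then 1 / 2 else 1

/-- The number of ways to write a number `≤ L` as a combination of the entries of the list with
coefficients in `ℕ`, where combinations equal to `L` count one half. -/
noncomputable def weightedCount : List ℝ → ℝ → ℝ
  | [], L => halfStep L
  | a :: t, L => ∑ j ∈ Finset.range (⌊L / a⌋₊ + 1), weightedCount t (L - j * a)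

lemma hasCount_singleton (hl : Incommensurable l) (hF : AvoidsPoles l F δ) (b : ι) {L : ℝ}
    (hL : 0 ≤ L) : HasCount l F {b} L (weightedCount [l b] L) := by
  have hb := hl.pos b
  have h1 := Nat.floor_le (div_nonneg hL hb.le)
  have h2 := Nat.lt_floor_add_one (L / l b)
  rw [le_div_iff₀ hb] at h1
  rw [div_lt_iff₀ hb] at h2
  set n := ⌊L / l b⌋₊ with hn
  have hlt : ∀ j < n, halfStep (L - j * l b) = 1 := by
    intro j hj
    have : (j + 1 : ℝ) ≤ n := by exact_mod_cast hj
    have : 0 < L - j * l b := by nlinarith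
    rw [halfStep, if_neg this.not_gt, if_neg this.ne']
  have hsum : ∑ j ∈ Finset.range n, halfStep (L - j * l b) = ∑ j ∈ Finset.range n, 1 :=
    Finset.sum_congr rfl fun j hj => hlt j (Finset.mem_range.1 hj)
  simp only [weightedCount, ← hn]
  rw [Finset.sum_range_succ, hsum, ← insert_empty_eq b]
  -- If L = n l_b, one more step would land on -l_b, the excluded end of the strip where the
  -- integral vanishes; so the descent stops at 0 instead.
  rcases h1.eq_or_lt with h | h
  · rw [halfStep, if_neg (by linarith), if_pos (by linarith)]
    refine HasCount.insert_of_sub_mul hl hF (Finset.notMem_empty b) n (w := fun _ => 1) ?_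
      fun j _ => hasCount_empty hl hF _
    rw [h, sub_self]
    exact hasCount_singleton_zero hl hF b
  · rw [halfStep, if_neg (by linarith), if_neg (by linarith),
      ← Finset.sum_range_succ (fun _ => (1 : ℝ)), ← add_zero (∑ j ∈ Finset.range _, (1 : ℝ))]
    refine HasCount.insert_of_sub_mul hl hF (Finset.notMem_empty b) (n + 1) (w := fun _ => 1) ?_
      fun j _ => hasCount_empty hl hF _
    refine hasCount_zero hl hF (by simp) ?_ ?_ <;> push_cast
    · linarith
    · simp only [insert_empty_eq, Finset.sum_singleton]
      linarith

/-- After ⌊L / l_b⌋ + 1 steps the argument lies in [-l_b, 0). With at least one further base this is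
inside the open strip of vanishing, so no boundary case arises beyond singletons. -/
theorem hasCount_weightedCount (hl : Incommensurable l) (hF : AvoidsPoles l F δ) (b : ι)
    (t : List ι) (hnd : (b :: t).Nodup) (hlen : (b :: t).length ≤ 4) {L : ℝ} (hL : 0 ≤ L) :
    HasCount l F (b :: t).toFinset L (weightedCount ((b :: t).map l) L) := by
  induction t generalizing b L with
  | nil => simpa using hasCount_singleton hl hF b hL
  | cons c t ih =>
    have hb := hl.pos b
    have h1 := Nat.floor_le (div_nonneg hL hb.le)
    have h2 := Nat.lt_floor_add_one (L / l b)
    rw [le_div_iff₀ hb] at h1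
    rw [div_lt_iff₀ hb] at h2
    have hbt : b ∉ (c :: t).toFinset := by
      rw [List.mem_toFinset]
      exact (List.nodup_cons.1 hnd).1
    have hpos : 0 < ∑ i ∈ (c :: t).toFinset, l i :=
      Finset.sum_pos (fun i _ => hl.pos i) ⟨c, by simp⟩
    rw [List.toFinset_cons, List.map_cons, weightedCount, ← add_zero (Finset.sum _ _)]
    refine HasCount.insert_of_sub_mul hl hF hbt _
      (w := fun j : ℕ => weightedCount ((c :: t).map l) (L - j * l b)) ?_ fun j hj => ?_
    · refine hasCount_zero hl hF ?_ ?_ ?_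
      · rw [← List.toFinset_cons]
        exact (List.toFinset_card_le _).trans hlen
      · push_cast
        linarith
      · rw [Finset.sum_insert hbt]
        push_cast
        linarith
    · refine ih c (List.nodup_cons.1 hnd).2 ((Nat.le_succ _).trans hlen) ?_
      have : (j : ℝ) ≤ ⌊L / l b⌋₊ := by exact_mod_cast Nat.lt_succ_iff.1 hj
      nlinarith

end recursion

/-! ### The residues in terms of trigonometric functions -/

section trig

variable {ι : Type*} (l : ι → ℝ) (L : ℝ)

/-- The cotangents that occur in the residues. -/
noncomputable def poleCot (l : ι → ℝ) (i j : ι) (k : ℕ) : ℝ :=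
  Real.cos (Real.pi * k * l j / l i) / Real.sin (Real.pi * k * l j / l i)

/-- The terms of the sine series of the sawtooth function. -/
noncomputable def sawTerm (i : ι) (k : ℕ) : ℝ := Real.sin (2 * Real.pi * k * (L / l i)) / k

/-- The terms of the series attached to a pair of indices. -/
noncomputable def pairTerm (i j : ι) (k : ℕ) : ℝ :=
  Real.cos (2 * Real.pi * k * ((L - 1 / 2 * l j) / l i))
    / (k * Real.sin (Real.pi * k * l j / l i))

/-- The terms of the series attached to a triple of indices. -/
noncomputable def tripleTerm (i j m : ι) (k : ℕ) : ℝ :=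
  Real.sin (2 * Real.pi * k * ((L + 1 / 2 * l j - 1 / 2 * l m) / l i))
      / (k * Real.sin (Real.pi * k * l j / l i) * Real.sin (Real.pi * k * l m / l i))
    + Real.sin (2 * Real.pi * k * ((L - 1 / 2 * l j + 1 / 2 * l m) / l i))
      / (k * Real.sin (Real.pi * k * l j / l i) * Real.sin (Real.pi * k * l m / l i))

/-- The terms of the series attached to a quadruple of indices. -/
noncomputable def quadTerm (i j m n : ι) (k : ℕ) : ℝ :=
  Real.cos (Real.pi * k * l j / l i) * Real.cos (Real.pi * k * l m / l i)
      * Real.cos (Real.pi * k * l n / l i) * Real.cos (2 * Real.pi * k * (L / l i))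
    / (k * Real.sin (Real.pi * k * l j / l i) * Real.sin (Real.pi * k * l m / l i)
        * Real.sin (Real.pi * k * l n / l i))

variable {l}

lemma sin_ne_zero_of_incommensurable (hl : Incommensurable l) {i j : ι} (hij : i ≠ j) {k : ℕ}
    (hk : k ≠ 0) : Real.sin (Real.pi * k * l j / l i) ≠ 0 := by
  rw [Ne, Real.sin_eq_zero_iff]
  rintro ⟨n, hn⟩
  have h1 := (hl.pos i).ne'
  refine hl.ne i j hij k n (by exact_mod_cast hk) ?_
  rw [eq_div_iff h1] at hn
  have : Real.pi * ((k : ℝ) * l j - n * l i) = 0 := by linear_combination -hn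
  rcases mul_eq_zero.1 this with h | h
  · exact absurd h Real.pi_pos.ne'
  · push_cast
    linarith

/-- The half shift in the cosine adds a sawtooth term to cos · cot. Undoing such shifts produces the
coefficients 2, 4 and 7 of the sawtooth terms in the residues below. -/
lemma pairTerm_eq (hl : Incommensurable l) {i j : ι} (hij : i ≠ j) {k : ℕ} (hk : k ≠ 0) :
    pairTerm l L i j k = (Real.cos (2 * Real.pi * k * (L / l i))
      * poleCot l i j k
      + Real.sin (2 * Real.pi * k * (L / l i))) / k := by
  have hs := sin_ne_zero_of_incommensurable hl hij hk
  have hk : (k : ℝ) ≠ 0 := by exact_mod_cast hk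
  rw [pairTerm, poleCot, show 2 * Real.pi * k * ((L - 1 / 2 * l j) / l i)
    = 2 * Real.pi * k * (L / l i) - Real.pi * k * l j / l i by ring, Real.cos_sub]
  generalize Real.sin (Real.pi * k * l j / l i) = x at *
  field_simp

lemma tripleTerm_eq (hl : Incommensurable l) {i j m : ι} (hij : i ≠ j) (him : i ≠ m) {k : ℕ}
    (hk : k ≠ 0) :
    tripleTerm l L i j m k = 2 * Real.sin (2 * Real.pi * k * (L / l i))
      * (poleCot l i j k * poleCot l i m k + 1) / k := by
  have hs := sin_ne_zero_of_incommensurable hl hij hk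
  have hs' := sin_ne_zero_of_incommensurable hl him hk
  have hk : (k : ℝ) ≠ 0 := by exact_mod_cast hk
  rw [tripleTerm, poleCot, poleCot, show 2 * Real.pi * k * ((L + 1 / 2 * l j - 1 / 2 * l m) / l i)
      = 2 * Real.pi * k * (L / l i) + (Real.pi * k * l j / l i - Real.pi * k * l m / l i) by ring,
    show 2 * Real.pi * k * ((L - 1 / 2 * l j + 1 / 2 * l m) / l i)
      = 2 * Real.pi * k * (L / l i) - (Real.pi * k * l j / l i - Real.pi * k * l m / l i) by ring,
    Real.sin_sub, Real.sin_add, Real.cos_sub]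
  generalize Real.sin (Real.pi * k * l j / l i) = x at *
  generalize Real.sin (Real.pi * k * l m / l i) = y at *
  field_simp
  ring

lemma quadTerm_eq (i j m n : ι) (k : ℕ) :
    quadTerm l L i j m n k = Real.cos (2 * Real.pi * k * (L / l i))
      * poleCot l i j k
      * poleCot l i m k
      * poleCot l i n k / k := by
  rw [quadTerm, poleCot, poleCot, poleCot]
  simp only [div_eq_mul_inv, mul_inv]
  ring

/-- This is 1 - e^{-2iφ} = 2 sin φ (sin φ + i cos φ), whose last factor has modulus 1. -/
lemma inv_one_sub_exp {φ : ℝ} (h : Real.sin φ ≠ 0) :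
    (1 - Complex.exp (-(2 * φ * Complex.I)))⁻¹
      = (1 - Complex.I * ((Real.cos φ / Real.sin φ : ℝ) : ℂ)) / 2 := by
  have hs : (Real.sin φ : ℂ) ≠ 0 := by exact_mod_cast h
  have hI := Complex.I_sq
  have e : 1 - Complex.exp (-(2 * φ * Complex.I))
      = 2 * Real.sin φ * (Real.sin φ + Real.cos φ * Complex.I) := by
    rw [show -(2 * (φ : ℂ) * Complex.I) = (-φ : ℂ) * Complex.I + (-φ : ℂ) * Complex.I by ring,
      Complex.exp_add, Complex.exp_mul_I, Complex.cos_neg, Complex.sin_neg, Complex.ofReal_sin,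
      Complex.ofReal_cos]
    have := Complex.sin_sq_add_cos_sq (φ : ℂ)
    linear_combination (-1 : ℂ) * this - Complex.sin (φ : ℂ) ^ 2 * hI
  have h2 : ((Real.sin φ : ℂ) + Real.cos φ * Complex.I)
      * (Real.sin φ - Real.cos φ * Complex.I) = 1 := by
    have h3 : (Real.sin φ : ℂ) ^ 2 + (Real.cos φ : ℂ) ^ 2 = 1 := by
      exact_mod_cast Real.sin_sq_add_cos_sq φ
    linear_combination h3 - (Real.cos φ : ℂ) ^ 2 * hI
  rw [e]
  refine inv_eq_of_mul_eq_one_right ?_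
  push_cast
  rw [← Complex.ofReal_sin, ← Complex.ofReal_cos]
  field_simp
  linear_combination h2

variable [DecidableEq ι]

lemma poleResidue_pos (hl : Incommensurable l) {A : Finset ι} {i : ι} {k : ℕ} (hk : k ≠ 0) :
    poleResidue l A L i k = (Real.cos (2 * Real.pi * k * (L / l i))
        + Real.sin (2 * Real.pi * k * (L / l i)) * Complex.I) / (2 * Real.pi * k * Complex.I)
      * ∏ j ∈ A.erase i, ((1 - Complex.I * (poleCot l i j k : ℂ)) / 2) := by
  have h1 : (l i : ℂ) ≠ 0 := by exact_mod_cast (hl.pos i).ne'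
  rw [poleResidue, div_eq_mul_inv, mul_inv, ← mul_assoc, ← Finset.prod_inv_distrib,
    ← div_eq_mul_inv]
  congr 1
  · congr 1
    · rw [Complex.ofReal_cos, Complex.ofReal_sin, ← Complex.exp_mul_I]
      congr 1
      simp only [pole]
      push_cast
      ring
    · simp only [pole]
      push_cast
      field_simp
  · refine Finset.prod_congr rfl fun j hj => ?_
    rw [poleCot, ← inv_one_sub_exp (sin_ne_zero_of_incommensurable hl
      (Finset.ne_of_mem_erase hj).symm hk)]
    congr 4
    simp only [pole]
    push_cast
    ring

lemma poleResidue_neg (hl : Incommensurable l) {A : Finset ι} {i : ι} {k : ℕ} (hk : k ≠ 0) :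
    poleResidue l A L i (-(k : ℤ)) = -(Real.cos (2 * Real.pi * k * (L / l i))
        - Real.sin (2 * Real.pi * k * (L / l i)) * Complex.I) / (2 * Real.pi * k * Complex.I)
      * ∏ j ∈ A.erase i, ((1 + Complex.I * (poleCot l i j k : ℂ)) / 2) := by
  have h1 : (l i : ℂ) ≠ 0 := by exact_mod_cast (hl.pos i).ne'
  rw [poleResidue, div_eq_mul_inv, mul_inv, ← mul_assoc, ← Finset.prod_inv_distrib,
    ← div_eq_mul_inv]
  congr 1
  · rw [neg_div, ← div_neg]
    congr 1
    · rw [Complex.ofReal_cos, Complex.ofReal_sin, sub_eq_add_neg, ← neg_mul, ← Complex.sin_neg,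
        ← Complex.cos_neg, ← Complex.exp_mul_I]
      congr 1
      simp only [pole]
      push_cast
      ring
    · simp only [pole]
      push_cast
      field_simp
  · refine Finset.prod_congr rfl fun j hj => ?_
    have hs := sin_ne_zero_of_incommensurable hl (Finset.ne_of_mem_erase hj).symm hk
    have h2 := inv_one_sub_exp (φ := -(Real.pi * k * l j / l i)) (by rwa [Real.sin_neg, neg_ne_zero])
    rw [Real.cos_neg, Real.sin_neg, div_neg] at h2
    rw [poleCot, show 1 + Complex.I * ((Real.cos (Real.pi * k * l j / l i)
      / Real.sin (Real.pi * k * l j / l i) : ℝ) : ℂ) = 1 - Complex.I * ((-(Real.cos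
      (Real.pi * k * l j / l i) / Real.sin (Real.pi * k * l j / l i)) : ℝ) : ℂ) by push_cast; ring,
      ← h2]
    congr 4
    simp only [pole]
    push_cast
    ring

lemma poleResidue_add_one (hl : Incommensurable l) {A : Finset ι} {i : ι} (hA : A.erase i = ∅)
    {k : ℕ} (hk : k ≠ 0) : poleResidue l A L i k + poleResidue l A L i (-(k : ℤ))
      = ((1 / Real.pi * sawTerm l L i k : ℝ) : ℂ) := by
  rw [poleResidue_pos L hl hk, poleResidue_neg L hl hk, hA, sawTerm]
  have hk : (k : ℂ) ≠ 0 := by exact_mod_cast hk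
  have hpi : (Real.pi : ℂ) ≠ 0 := by exact_mod_cast Real.pi_pos.ne'
  simp only [Finset.prod_empty, mul_one]
  generalize Real.cos (2 * Real.pi * k * (L / l i)) = c
  generalize Real.sin (2 * Real.pi * k * (L / l i)) = s
  push_cast
  field_simp
  ring

lemma poleResidue_add_two (hl : Incommensurable l) {A : Finset ι} {i j : ι}
    (hA : A.erase i = {j}) (hij : i ≠ j) {k : ℕ} (hk : k ≠ 0) :
    poleResidue l A L i k + poleResidue l A L i (-(k : ℤ))
      = ((1 / (2 * Real.pi) * (2 * sawTerm l L i k - pairTerm l L i j k) : ℝ) : ℂ) := by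
  rw [poleResidue_pos L hl hk, poleResidue_neg L hl hk, hA, sawTerm, pairTerm_eq L hl hij hk]
  have hk : (k : ℂ) ≠ 0 := by exact_mod_cast hk
  have hpi : (Real.pi : ℂ) ≠ 0 := by exact_mod_cast Real.pi_pos.ne'
  simp only [Finset.prod_singleton]
  generalize Real.cos (2 * Real.pi * k * (L / l i)) = c
  generalize Real.sin (2 * Real.pi * k * (L / l i)) = s
  generalize poleCot l i j k = a
  push_cast
  field_simp
  ring

lemma poleResidue_add_three (hl : Incommensurable l) {A : Finset ι} {i j m : ι}
    (hA : A.erase i = {j, m}) (hij : i ≠ j) (him : i ≠ m) (hjm : j ≠ m) {k : ℕ} (hk : k ≠ 0) :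
    poleResidue l A L i k + poleResidue l A L i (-(k : ℤ))
      = ((1 / (4 * Real.pi) * (4 * sawTerm l L i k - tripleTerm l L i j m k / 2
        - pairTerm l L i j k - pairTerm l L i m k) : ℝ) : ℂ) := by
  rw [poleResidue_pos L hl hk, poleResidue_neg L hl hk, hA, sawTerm, pairTerm_eq L hl hij hk,
    pairTerm_eq L hl him hk, tripleTerm_eq L hl hij him hk]
  have hk : (k : ℂ) ≠ 0 := by exact_mod_cast hk
  have hpi : (Real.pi : ℂ) ≠ 0 := by exact_mod_cast Real.pi_pos.ne'
  simp only [Finset.prod_pair hjm]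
  generalize Real.cos (2 * Real.pi * k * (L / l i)) = c
  generalize Real.sin (2 * Real.pi * k * (L / l i)) = s
  generalize poleCot l i j k = a
  generalize poleCot l i m k = b
  push_cast
  field_simp
  ring_nf
  simp only [Complex.I_pow_three]
  ring

/-- The two residues are conjugate. With e₁, e₂, e₃ the elementary symmetric functions of the three
cotangents, and c, s the cosine and sine of 2πkL/l_i, their sum is (s(1 - e₂) - c e₁ + c e₃)/(8πk).
The triple terms absorb -s e₂ at the cost of 3s and the pair terms absorb -c e₁ at the cost of 3s,
whence 7 = 1 + 3 + 3. -/
lemma poleResidue_add_four (hl : Incommensurable l) {A : Finset ι} {i j m n : ι}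
    (hA : A.erase i = {j, m, n}) (hij : i ≠ j) (him : i ≠ m) (hin : i ≠ n) (hjm : j ≠ m)
    (hjn : j ≠ n) (hmn : m ≠ n) {k : ℕ} (hk : k ≠ 0) :
    poleResidue l A L i k + poleResidue l A L i (-(k : ℤ))
      = ((1 / (8 * Real.pi) * (7 * sawTerm l L i k - (tripleTerm l L i j m k
        + tripleTerm l L i j n k + tripleTerm l L i m n k) / 2
        - (pairTerm l L i j k + pairTerm l L i m k + pairTerm l L i n k)
        + quadTerm l L i j m n k) : ℝ) : ℂ) := by
  rw [poleResidue_pos L hl hk, poleResidue_neg L hl hk, hA, sawTerm, pairTerm_eq L hl hij hk,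
    pairTerm_eq L hl him hk, pairTerm_eq L hl hin hk, tripleTerm_eq L hl hij him hk,
    tripleTerm_eq L hl hij hin hk, tripleTerm_eq L hl him hin hk, quadTerm_eq]
  have hk : (k : ℂ) ≠ 0 := by exact_mod_cast hk
  have hpi : (Real.pi : ℂ) ≠ 0 := by exact_mod_cast Real.pi_pos.ne'
  rw [Finset.prod_insert (by simp [hjm, hjn]), Finset.prod_pair hmn,
    Finset.prod_insert (by simp [hjm, hjn]), Finset.prod_pair hmn]
  generalize Real.cos (2 * Real.pi * k * (L / l i)) = c
  generalize Real.sin (2 * Real.pi * k * (L / l i)) = s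
  generalize poleCot l i j k = a
  generalize poleCot l i m k = b
  generalize poleCot l i n k = d
  push_cast
  field_simp
  ring_nf
  simp only [Complex.I_pow_three]
  ring

end trig

/-! ### Weighted counts of smooth numbers -/

lemma weightedCount_of_neg {t : List ℝ} (ht : ∀ a ∈ t, 0 < a) {L : ℝ} (hL : L < 0) :
    weightedCount t L = 0 := by
  induction t with
  | nil => rw [weightedCount, halfStep, if_pos hL]
  | cons a t ih =>
    have ha : 0 < a := ht a (by simp)
    have h1 : ⌊L / a⌋₊ = 0 := Nat.floor_of_nonpos (div_nonpos_of_nonpos_of_nonneg hL.le ha.le)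
    simpa [weightedCount, h1] using ih fun b hb => ht b (List.mem_cons_of_mem a hb)

/-- Terms beyond the floor have negative argument and vanish. With a common M the nested sums become
one sum over a box. -/
lemma weightedCount_cons_of_lt {a : ℝ} {t : List ℝ} (ha : 0 < a) (ht : ∀ b ∈ t, 0 < b) {L : ℝ}
    {M : ℕ} (hM : L < M * a) (hM0 : M ≠ 0) :
    weightedCount (a :: t) L = ∑ j ∈ Finset.range M, weightedCount t (L - j * a) := by
  rw [weightedCount]
  have h2 := Nat.lt_floor_add_one (L / a)
  rw [div_lt_iff₀ ha] at h2
  refine Finset.sum_subset (fun j hj => ?_) fun j _ hj => ?_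
  · rw [Finset.mem_range] at *
    refine lt_of_le_of_lt (Nat.lt_succ_iff.1 hj) ?_
    rw [Nat.floor_lt' hM0, div_lt_iff₀ ha]
    exact hM
  · rw [Finset.mem_range, not_lt] at hj
    have : ((⌊L / a⌋₊ : ℝ) + 1) ≤ j := by exact_mod_cast hj
    exact weightedCount_of_neg ht (by nlinarith)

/-- The convention that B₁* is 0 at integers matches the half weight of the last term. -/
lemma weightedCount_singleton {a L : ℝ} (ha : 0 < a) (hL : 0 ≤ L) :
    weightedCount [a] L = L / a + 1 / 2 - bernoulliStar (L / a) := by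
  have h0 := div_nonneg hL ha.le
  have h1 := Nat.floor_le h0
  have h2 := Nat.lt_floor_add_one (L / a)
  rw [le_div_iff₀ ha] at h1
  rw [div_lt_iff₀ ha] at h2
  simp only [weightedCount]
  have hsum : ∑ j ∈ Finset.range ⌊L / a⌋₊, halfStep (L - j * a)
      = ∑ j ∈ Finset.range ⌊L / a⌋₊, 1 := by
    refine Finset.sum_congr rfl fun j hj => ?_
    have : (j + 1 : ℝ) ≤ ⌊L / a⌋₊ := by exact_mod_cast Finset.mem_range.1 hj
    have : 0 < L - j * a := by nlinarith
    rw [halfStep, if_neg this.not_gt, if_neg this.ne']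
  rw [Finset.sum_range_succ, hsum]
  simp only [Finset.sum_const, Finset.card_range, nsmul_eq_mul, mul_one]
  rw [bernoulliStar]
  split_ifs with h
  · obtain ⟨n, hn⟩ := h
    have hfl : (⌊L / a⌋₊ : ℝ) = L / a := by
      rw [natCast_floor_eq_intCast_floor h0, ← hn, Int.floor_intCast]
    have : L - ⌊L / a⌋₊ * a = 0 := by rw [hfl]; field_simp; ring
    rw [this, halfStep, if_neg (lt_irrefl _), if_pos rfl, hfl]
    ring
  · have : 0 < L - ⌊L / a⌋₊ * a := by
      refine lt_of_le_of_ne (by linarith) fun h' => h ⟨⌊L / a⌋₊, ?_⟩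
      rw [Int.cast_natCast, eq_div_iff ha.ne']
      linarith
    rw [halfStep, if_neg this.not_gt, if_neg this.ne', Int.fract,
      natCast_floor_eq_intCast_floor h0]
    ring

/-- The smooth number with the given exponents. -/
def smoothNumber (e : ℕ × ℕ × ℕ × ℕ) : ℕ := 2 ^ e.1 * 3 ^ e.2.1 * 5 ^ e.2.2.1 * 7 ^ e.2.2.2

lemma smoothNumber_pos (e : ℕ × ℕ × ℕ × ℕ) : 0 < smoothNumber e := by
  unfold smoothNumber
  positivity

lemma smoothNumber_injective : Function.Injective smoothNumber := by
  rintro ⟨p, q, r, f⟩ ⟨p', q', r', f'⟩ h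
  simp only [smoothNumber] at h
  have key : ∀ p q r f : ℕ, (2 ^ p * 3 ^ q * 5 ^ r * 7 ^ f).factorization
      = Finsupp.single 2 p + Finsupp.single 3 q + Finsupp.single 5 r + Finsupp.single 7 f := by
    intro p q r f
    rw [Nat.factorization_mul (by positivity) (by positivity),
      Nat.factorization_mul (by positivity) (by positivity),
      Nat.factorization_mul (by positivity) (by positivity),
      Nat.Prime.factorization_pow (by norm_num), Nat.Prime.factorization_pow (by norm_num),
      Nat.Prime.factorization_pow (by norm_num), Nat.Prime.factorization_pow (by norm_num)]
  have h' := congrArg Nat.factorization h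
  rw [key, key] at h'
  have h2 := DFunLike.congr_fun h' 2
  have h3 := DFunLike.congr_fun h' 3
  have h5 := DFunLike.congr_fun h' 5
  have h7 := DFunLike.congr_fun h' 7
  simp at h2 h3 h5 h7
  simp [h2, h3, h5, h7]

lemma log_smoothNumber (e : ℕ × ℕ × ℕ × ℕ) : Real.log (smoothNumber e)
    = e.1 * Real.log 2 + e.2.1 * Real.log 3 + e.2.2.1 * Real.log 5 + e.2.2.2 * Real.log 7 := by
  rw [smoothNumber]
  push_cast
  rw [Real.log_mul (by positivity) (by positivity), Real.log_mul (by positivity) (by positivity),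
    Real.log_mul (by positivity) (by positivity), Real.log_pow, Real.log_pow, Real.log_pow,
    Real.log_pow]

lemma halfStep_log_sub {x n : ℝ} (hx : 0 < x) (hn : 0 < n) :
    halfStep (Real.log x - Real.log n) = (if n ≤ x then 1 else 0) - 1 / 2 * if n = x then 1 else 0 := by
  rw [halfStep]
  rcases lt_trichotomy n x with h | h | h
  · have := Real.log_lt_log hn h
    rw [if_neg (by linarith), if_neg (by linarith), if_pos h.le, if_neg h.ne]
    ring
  · subst h
    norm_num
  · have := Real.log_lt_log hx h
    rw [if_pos (by linarith), if_neg h.not_ge, if_neg h.ne']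
    ring

/-- Both sides are sums over one box of exponents. The half weight is met only by exponents of x
itself, of which there is at most one quadruple by unique factorization. -/
theorem weightedCount_log_eq {x : ℝ} (hx : 1 ≤ x) :
    weightedCount [Real.log 2, Real.log 3, Real.log 5, Real.log 7] (Real.log x)
      = sevenSmoothCount x - 1 / 2 * sevenSmoothChar x := by
  have hx0 : 0 < x := by linarith
  have l2 : 0 < Real.log 2 := Real.log_pos (by norm_num)
  have l3 : Real.log 2 ≤ Real.log 3 := Real.log_le_log (by norm_num) (by norm_num)
  have l5 : Real.log 2 ≤ Real.log 5 := Real.log_le_log (by norm_num) (by norm_num)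
  have l7 : Real.log 2 ≤ Real.log 7 := Real.log_le_log (by norm_num) (by norm_num)
  set L := Real.log x with hL
  have hL0 : 0 ≤ L := Real.log_nonneg hx
  -- Since log 2 is the smallest logarithm, this bounds all four exponents.
  set M := ⌊L / Real.log 2⌋₊ + 1 with hM
  have hML : L < M * Real.log 2 := by
    have := Nat.lt_floor_add_one (L / Real.log 2)
    rw [div_lt_iff₀ l2] at this
    rw [hM]
    push_cast
    exact this
  have hM0 : M ≠ 0 := Nat.succ_ne_zero _
  have hMr : (0 : ℝ) ≤ M := Nat.cast_nonneg M
  set B := Finset.range M ×ˢ Finset.range M ×ˢ Finset.range M ×ˢ Finset.range M with hB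
  have hW : weightedCount [Real.log 2, Real.log 3, Real.log 5, Real.log 7] L
      = ∑ e ∈ B, halfStep (L - Real.log (smoothNumber e)) := by
    rw [hB, Finset.sum_product]
    rw [weightedCount_cons_of_lt l2 (by simp; exact ⟨by linarith, by linarith, by linarith⟩) hML hM0]
    refine Finset.sum_congr rfl fun p _ => ?_
    rw [Finset.sum_product]
    have hp : 0 ≤ p * Real.log 2 := by positivity
    rw [weightedCount_cons_of_lt (by linarith) (by simp; exact ⟨by linarith, by linarith⟩)
      (by nlinarith) hM0]
    refine Finset.sum_congr rfl fun q _ => ?_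
    rw [Finset.sum_product]
    have hq : 0 ≤ q * Real.log 3 := mul_nonneg (Nat.cast_nonneg q) (by linarith)
    rw [weightedCount_cons_of_lt (by linarith) (by simp; linarith) (by nlinarith) hM0]
    refine Finset.sum_congr rfl fun r _ => ?_
    have hr : 0 ≤ r * Real.log 5 := mul_nonneg (Nat.cast_nonneg r) (by linarith)
    rw [weightedCount_cons_of_lt (by linarith) (by simp) (by nlinarith) hM0]
    refine Finset.sum_congr rfl fun f _ => ?_
    rw [weightedCount, log_smoothNumber]
    congr 1
    ring
  have hmem : ∀ e, (smoothNumber e : ℝ) ≤ x → e ∈ B := by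
    intro e he
    have h1 : Real.log (smoothNumber e) ≤ L :=
      Real.log_le_log (by exact_mod_cast smoothNumber_pos e) he
    rw [log_smoothNumber] at h1
    have n1 : (0 : ℝ) ≤ e.1 * Real.log 2 := by positivity
    have n2 : (0 : ℝ) ≤ e.2.1 * Real.log 2 := by positivity
    have n3 : (0 : ℝ) ≤ e.2.2.1 * Real.log 2 := by positivity
    have n4 : (0 : ℝ) ≤ e.2.2.2 * Real.log 2 := by positivity
    have m2 := mul_le_mul_of_nonneg_left l3 (Nat.cast_nonneg (α := ℝ) e.2.1)
    have m3 := mul_le_mul_of_nonneg_left l5 (Nat.cast_nonneg (α := ℝ) e.2.2.1)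
    have m4 := mul_le_mul_of_nonneg_left l7 (Nat.cast_nonneg (α := ℝ) e.2.2.2)
    have key : ∀ k : ℕ, k * Real.log 2 ≤ L → k < M := fun k hk => by
      have := lt_of_mul_lt_mul_right (hk.trans_lt hML) l2.le
      exact_mod_cast this
    simp only [hB, Finset.mem_product, Finset.mem_range]
    exact ⟨key _ (by linarith), key _ (by linarith), key _ (by linarith), key _ (by linarith)⟩
  have hN : (sevenSmoothCount x : ℝ) = ∑ e ∈ B, if (smoothNumber e : ℝ) ≤ x then (1 : ℝ) else 0 := by
    rw [Finset.sum_boole, sevenSmoothCount]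
    congr 1
    rw [← Set.ncard_coe_finset]
    congr 1
    ext e
    have hcast : (2 : ℝ) ^ e.1 * 3 ^ e.2.1 * 5 ^ e.2.2.1 * 7 ^ e.2.2.2 = smoothNumber e := by
      rw [smoothNumber]; push_cast; rfl
    simp only [Set.mem_ofPred_eq, hcast, Finset.coe_filter]
    exact ⟨fun h => ⟨hmem e h, h⟩, fun h => h.2⟩
  have hχ : sevenSmoothChar x = ∑ e ∈ B, if (smoothNumber e : ℝ) = x then (1 : ℝ) else 0 := by
    rw [sevenSmoothChar]
    by_cases h : x ∈ sevenSmoothSet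
    · rw [Set.indicator_of_mem h]
      obtain ⟨p, q, r, f, h⟩ := h
      have hcast : x = smoothNumber (p, q, r, f) := by
        rw [h, smoothNumber]; push_cast; rfl
      rw [Finset.sum_eq_single_of_mem (p, q, r, f) (hmem _ hcast.ge), if_pos hcast.symm]
      intro e _ he
      refine if_neg fun h' => he (smoothNumber_injective ?_)
      rw [hcast] at h'
      exact_mod_cast h'
    · rw [Set.indicator_of_notMem h]
      refine (Finset.sum_eq_zero fun e _ => if_neg fun h' => h ⟨e.1, e.2.1, e.2.2.1, e.2.2.2, ?_⟩).symm
      rw [← h', smoothNumber]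
      push_cast
      rfl
  rw [hW, hN, hχ, Finset.mul_sum, ← Finset.sum_sub_distrib]
  exact Finset.sum_congr rfl fun e _ =>
    halfStep_log_sub hx0 (by exact_mod_cast smoothNumber_pos e)

/-! ### The logarithms of the bases -/

/-- The logarithms of `2`, `3`, `5` and `7`. -/
noncomputable def logBase : Fin 4 → ℝ := ![Real.log 2, Real.log 3, Real.log 5, Real.log 7]

lemma logBase_eq (i : Fin 4) : logBase i = Real.log ((![2, 3, 5, 7] : Fin 4 → ℕ) i) := by
  fin_cases i <;> simp [logBase]

/-- A relation would give p^|k| = q^|m| with k ≠ 0 for distinct primes p and q, so p would divide q.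
-/
lemma incommensurable_logBase : Incommensurable logBase := by
  have hprime : ∀ i : Fin 4, ((![2, 3, 5, 7] : Fin 4 → ℕ) i).Prime := by
    intro i; fin_cases i <;> norm_num
  have hinj : Function.Injective (![2, 3, 5, 7] : Fin 4 → ℕ) := by decide
  have hpos : ∀ i, 0 < logBase i := fun i => by
    rw [logBase_eq]
    exact Real.log_pos (by exact_mod_cast (hprime i).one_lt)
  refine ⟨hpos, fun i j hij k m hk h => hij (hinj ?_)⟩
  have h1 := congrArg abs h
  rw [abs_mul, abs_mul, abs_of_pos (hpos i), abs_of_pos (hpos j), ← Int.cast_abs, ← Int.cast_abs,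
    Int.abs_eq_natAbs, Int.abs_eq_natAbs, Int.cast_natCast, Int.cast_natCast, logBase_eq,
    logBase_eq, ← Real.log_pow, ← Real.log_pow] at h1
  have h2 := Real.log_injOn_pos
    (Set.mem_Ioi.2 (pow_pos (by exact_mod_cast (hprime j).pos) _))
    (Set.mem_Ioi.2 (pow_pos (by exact_mod_cast (hprime i).pos) _)) h1
  have h3 : (![2, 3, 5, 7] : Fin 4 → ℕ) j ^ k.natAbs = (![2, 3, 5, 7] : Fin 4 → ℕ) i ^ m.natAbs := by
    exact_mod_cast h2
  have h4 := (dvd_pow_self _ (Int.natAbs_ne_zero.2 hk)).trans h3.dvd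
  exact ((Nat.prime_dvd_prime_iff_eq (hprime j) (hprime i)).1
    ((hprime j).dvd_of_dvd_pow h4)).symm

lemma avoidsPoles_admissible {δ : ℝ} (hδ : 0 < δ) : AvoidsPoles logBase (admissible δ) δ := by
  refine ⟨inf_le_left, hδ, ?_⟩
  have h : ∀ᶠ R in admissible δ, R ∈ {R : ℝ | ∀ p ∈ ({2, 3, 5, 7} : Set ℝ), ∀ n : ℤ,
      δ ≤ |R * Real.log p - n|} := mem_inf_of_right (mem_principal_self _)
  filter_upwards [h] with R hR i n
  rw [logBase_eq]
  refine hR _ ?_ n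
  fin_cases i <;> simp

lemma le_abs_sub_int_of_mem_Icc {t : ℝ} {δ : ℝ} (h1 : δ ≤ t) (h2 : t ≤ 1 - δ) (n : ℤ) :
    δ ≤ |t - n| := by
  rcases le_or_gt n 0 with h | h
  · have : (n : ℝ) ≤ 0 := by exact_mod_cast h
    exact le_abs.2 (Or.inl (by linarith))
  · have : (1 : ℝ) ≤ n := by exact_mod_cast h
    exact le_abs.2 (Or.inr (by linarith))

/-- Pigeonhole: if all five points R + j/10 with j ≤ 4 were bad, two of them would be bad for the
same base. Their difference times its logarithm lies in [1/20, 4/5], yet would be within 1/25 of an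
integer. -/
theorem admissible_neBot : ∃ δ : ℝ, 0 < δ ∧ (admissible δ).NeBot := by
  refine ⟨1 / 50, by norm_num, ?_⟩
  rw [admissible, Filter.inf_principal_neBot_iff]
  intro s hs
  obtain ⟨R, hR⟩ := mem_atTop_sets.1 hs
  by_contra hne
  rw [Set.not_nonempty_iff_eq_empty] at hne
  have hbad : ∀ j : Fin 5, ∃ i : Fin 4, ∃ n : ℤ,
      |(R + (j : ℕ) / 10) * logBase i - n| < 1 / 50 := by
    intro j
    by_contra! hcon
    have : R + (j : ℕ) / 10 ∈ s ∩ {R : ℝ | ∀ p ∈ ({2, 3, 5, 7} : Set ℝ), ∀ n : ℤ,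
        1 / 50 ≤ |R * Real.log p - n|} := by
      refine ⟨hR _ (le_add_of_nonneg_right (by positivity)), ?_⟩
      rintro p (rfl | rfl | rfl | rfl) n
      · simpa [logBase] using hcon 0 n
      · simpa [logBase] using hcon 1 n
      · simpa [logBase] using hcon 2 n
      · simpa [logBase] using hcon 3 n
    rw [hne] at this
    exact this
  have hbounds : ∀ i, 1 / 2 ≤ logBase i ∧ logBase i ≤ 2 := by
    have h2 := Real.log_two_gt_d9
    have h7 : Real.log 7 ≤ 2 := by
      rw [Real.log_le_iff_le_exp (by norm_num)]
      have := Real.exp_one_gt_d9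
      rw [show (2 : ℝ) = 1 + 1 by norm_num, Real.exp_add]
      nlinarith
    intro i
    have h1 : Real.log 2 ≤ logBase i := by
      rw [logBase_eq]
      refine Real.log_le_log (by norm_num) ?_
      fin_cases i <;> norm_num
    have h3 : logBase i ≤ Real.log 7 := by
      rw [logBase_eq]
      refine Real.log_le_log ?_ ?_ <;> fin_cases i <;> norm_num
    constructor <;> linarith
  choose i n hin using hbad
  obtain ⟨j, j', hjj, hi⟩ := Fintype.exists_ne_map_eq_of_card_lt i (by simp)
  wlog hlt : (j : ℕ) < j' generalizing j j'
  · exact this j' j hjj.symm hi.symm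
      (lt_of_le_of_ne (not_lt.1 hlt) fun h => hjj (Fin.ext h.symm))
  have h1 := hin j
  have h2 := hin j'
  rw [← hi] at h2
  obtain ⟨hb1, hb2⟩ := hbounds (i j)
  have hd1 : ((j : ℕ) : ℝ) + 1 ≤ (j' : ℕ) := by exact_mod_cast hlt
  have hd2 : ((j' : ℕ) : ℝ) ≤ (j : ℕ) + 4 := by
    have := j'.is_lt
    have : (j' : ℕ) ≤ j + 4 := by omega
    exact_mod_cast this
  have h3 := le_abs_sub_int_of_mem_Icc (t := (((j' : ℕ) : ℝ) - (j : ℕ)) / 10 * logBase (i j))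
    (δ := 1 / 25) (by nlinarith) (by nlinarith) (n j' - n j)
  have h4 := abs_sub ((R + (j' : ℕ) / 10) * logBase (i j) - n j')
    ((R + (j : ℕ) / 10) * logBase (i j) - n j)
  have h5 : (R + (j' : ℕ) / 10) * logBase (i j) - n j' - ((R + (j : ℕ) / 10) * logBase (i j) - n j)
      = (((j' : ℕ) : ℝ) - (j : ℕ)) / 10 * logBase (i j) - ((n j' - n j : ℤ) : ℝ) := by
    push_cast; ring
  rw [h5] at h4
  linarith

/-! ### Limits of the partial sums -/

section partialSums

variable {ι : Type*} {l : ι → ℝ}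

/-- `G` tends to `v` along all filters that avoid the poles. -/
def TendstoAvoiding (l : ι → ℝ) (G : ℝ → ℝ) (v : ℝ) : Prop :=
  ∀ (F : Filter ℝ) (δ : ℝ), AvoidsPoles l F δ → Tendsto G F (𝓝 v)

/-- The partial sum up to `⌊R * l i⌋`. -/
noncomputable def partialSum (l : ι → ℝ) (i : ι) (f : ℕ → ℝ) (R : ℝ) : ℝ :=
  ∑ k ∈ Finset.Icc 1 ⌊R * l i⌋₊, f k

lemma partialSum_const_mul (i : ι) (c : ℝ) (f : ℕ → ℝ) (R : ℝ) :
    partialSum l i (fun k => c * f k) R = c * partialSum l i f R := by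
  rw [partialSum, partialSum, Finset.mul_sum]

lemma partialSum_add (i : ι) (f g : ℕ → ℝ) (R : ℝ) :
    partialSum l i (fun k => f k + g k) R = partialSum l i f R + partialSum l i g R := by
  rw [partialSum, partialSum, partialSum, Finset.sum_add_distrib]

lemma partialSum_sub (i : ι) (f g : ℕ → ℝ) (R : ℝ) :
    partialSum l i (fun k => f k - g k) R = partialSum l i f R - partialSum l i g R := by
  rw [partialSum, partialSum, partialSum, Finset.sum_sub_distrib]

lemma partialSum_div (i : ι) (c : ℝ) (f : ℕ → ℝ) (R : ℝ) :
    partialSum l i (fun k => f k / c) R = partialSum l i f R / c := by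
  rw [partialSum, partialSum, Finset.sum_div]

variable [DecidableEq ι]

lemma residueSum_eq {A : Finset ι} {L : ℝ} {f : ι → ℕ → ℝ}
    (h : ∀ i ∈ A, ∀ k : ℕ, k ≠ 0 →
      poleResidue l A L i k + poleResidue l A L i (-(k : ℤ)) = (f i k : ℂ)) (R : ℝ) :
    residueSum l A L R = ((∑ i ∈ A, partialSum l i (f i) R : ℝ) : ℂ) := by
  simp only [residueSum, partialSum]
  push_cast
  exact Finset.sum_congr rfl fun i hi => Finset.sum_congr rfl fun k hk =>
    h i hi k (by have := (Finset.mem_Icc.1 hk).1; omega)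

/-- The partial sums of the residues off 0 tend to the count minus the residue at 0; every
convergence statement below is a case of this. -/
lemma tendstoAvoiding_of_residues (hl : Incommensurable l) (b : ι) (t : List ι)
    (hnd : (b :: t).Nodup) (hlen : (b :: t).length ≤ 4) {A : Finset ι}
    (hA : A = (b :: t).toFinset) {L : ℝ} (hL : 0 ≤ L) {a : ℕ → ℂ}
    (ha : HasTaylor (fun s => Complex.exp (s * L)
      * ∏ i ∈ A, (s / (1 - Complex.exp (-(s * l i))))) a) {f : ι → ℕ → ℝ}
    (h : ∀ i ∈ A, ∀ k : ℕ, k ≠ 0 →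
      poleResidue l A L i k + poleResidue l A L i (-(k : ℤ)) = (f i k : ℂ)) :
    TendstoAvoiding l (fun R => ∑ i ∈ A, partialSum l i (f i) R)
      (weightedCount ((b :: t).map l) L - (a A.card).re) := by
  intro F δ hF
  have hcard : A.card ≤ 4 := by
    rw [hA]
    exact (List.toFinset_card_le _).trans hlen
  have h1 := hasCount_weightedCount hl hF b t hnd hlen hL
  rw [← hA] at h1
  have h2 := (Complex.continuous_re.tendsto _).comp (h1.tendsto_residueSum hl hF hcard ha)
  rw [Complex.sub_re, Complex.ofReal_re] at h2
  refine h2.congr fun R => ?_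
  rw [Function.comp_apply, residueSum_eq h, Complex.ofReal_re]

/-- The case of one base: the residue at 0 is L / l_i + 1/2, so only -B₁* is left of the count. This
is the Fourier series of the sawtooth. -/
theorem tendstoAvoiding_sawTerm (hl : Incommensurable l) {L : ℝ} (hL : 0 ≤ L) (i : ι) :
    TendstoAvoiding l (partialSum l i (sawTerm l L i)) (-Real.pi * bernoulliStar (L / l i)) := by
  obtain ⟨a, ha, hT⟩ := hasTaylor_singleton hl i L
  have h := tendstoAvoiding_of_residues hl i [] (by simp) (by simp) (A := {i}) (by simp) hL hT
    (f := fun j k => 1 / Real.pi * sawTerm l L j k) (by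
      intro j hj k hk
      rw [Finset.mem_singleton] at hj
      subst hj
      exact poleResidue_add_one L hl (by simp) hk)
  intro F δ hF
  have h1 := (h F δ hF).const_mul Real.pi
  rw [Finset.card_singleton, ha, Complex.ofReal_re, List.map_cons, List.map_nil,
    weightedCount_singleton (hl.pos i) hL] at h1
  have hpi := Real.pi_pos.ne'
  convert h1 using 1
  · funext R
    rw [Finset.sum_singleton, partialSum_const_mul]
    field_simp
  · congr 1
    ring

/-- The two-base residues converge, and so do their sawtooth parts; the pair sums are what remains.
Only the sum over both bases is controlled, since the residue theorem does not separate them. -/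
theorem exists_tendstoAvoiding_pairTerm (hl : Incommensurable l) {L : ℝ} (hL : 0 ≤ L) {i j : ι}
    (hij : i ≠ j) : ∃ v, TendstoAvoiding l (fun R => partialSum l i (pairTerm l L i j) R
      + partialSum l j (pairTerm l L j i) R) v := by
  have hji := hij.symm
  obtain ⟨a, ha⟩ := exists_hasTaylor_kernel hl {i, j} L
  have h := tendstoAvoiding_of_residues hl i [j] (by simp [hij]) (by simp) (A := {i, j})
    (by simp) hL ha
    (f := fun p => if p = i then fun k => 1 / (2 * Real.pi) * (2 * sawTerm l L i k - pairTerm l L i j k)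
      else fun k => 1 / (2 * Real.pi) * (2 * sawTerm l L j k - pairTerm l L j i k)) (by
      intro p hp k hk
      rcases Finset.mem_insert.1 hp with rfl | hp
      · rw [if_pos rfl]
        exact poleResidue_add_two L hl (by ext; simp; grind) hij hk
      · rw [Finset.mem_singleton] at hp
        subst hp
        rw [if_neg hji]
        exact poleResidue_add_two L hl (by ext; simp; grind) hji hk)
  generalize weightedCount _ _ - _ = r at h
  refine ⟨2 * (-Real.pi * bernoulliStar (L / l i)) + 2 * (-Real.pi * bernoulliStar (L / l j))
    - 2 * Real.pi * r, fun F δ hF => ?_⟩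
  have h1 := (((tendstoAvoiding_sawTerm hl hL i F δ hF).const_mul 2).add
    ((tendstoAvoiding_sawTerm hl hL j F δ hF).const_mul 2)).sub
    ((h F δ hF).const_mul (2 * Real.pi))
  refine h1.congr fun R => ?_
  have hpi := Real.pi_pos.ne'
  rw [Finset.sum_pair hij, if_pos rfl, if_neg hji]
  simp only [partialSum_const_mul, partialSum_sub]
  field_simp
  ring

/-- The same subtraction with three bases, now removing the sawtooth sums and the three pair sums.
-/
theorem exists_tendstoAvoiding_tripleTerm (hl : Incommensurable l) {L : ℝ} (hL : 0 ≤ L)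
    {i j m : ι} (hij : i ≠ j) (him : i ≠ m) (hjm : j ≠ m) :
    ∃ v, TendstoAvoiding l (fun R => partialSum l i (tripleTerm l L i j m) R
      + partialSum l j (tripleTerm l L j i m) R + partialSum l m (tripleTerm l L m i j) R) v := by
  have hji := hij.symm
  have hmi := him.symm
  have hmj := hjm.symm
  obtain ⟨a, ha⟩ := exists_hasTaylor_kernel hl {i, j, m} L
  have h := tendstoAvoiding_of_residues hl i [j, m] (by simp [hij, him, hjm]) (by simp)
    (A := {i, j, m}) (by simp) hL ha
    (f := fun p => if p = i then fun k => 1 / (4 * Real.pi) * (4 * sawTerm l L i k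
        - tripleTerm l L i j m k / 2 - pairTerm l L i j k - pairTerm l L i m k)
      else if p = j then fun k => 1 / (4 * Real.pi) * (4 * sawTerm l L j k
        - tripleTerm l L j i m k / 2 - pairTerm l L j i k - pairTerm l L j m k)
      else fun k => 1 / (4 * Real.pi) * (4 * sawTerm l L m k
        - tripleTerm l L m i j k / 2 - pairTerm l L m i k - pairTerm l L m j k)) (by
      intro p hp k hk
      simp only [Finset.mem_insert, Finset.mem_singleton] at hp
      rcases hp with rfl | rfl | rfl
      · rw [if_pos rfl]
        exact poleResidue_add_three L hl (by ext; simp; grind) hij him hjm hk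
      · rw [if_neg hji, if_pos rfl]
        exact poleResidue_add_three L hl (by ext; simp; grind) hji hjm him hk
      · rw [if_neg hmi, if_neg hmj]
        exact poleResidue_add_three L hl (by ext; simp; grind) hmi hmj hij hk)
  obtain ⟨u, hu⟩ := exists_tendstoAvoiding_pairTerm hl hL hij
  obtain ⟨v, hv⟩ := exists_tendstoAvoiding_pairTerm hl hL him
  obtain ⟨w, hw⟩ := exists_tendstoAvoiding_pairTerm hl hL hjm
  generalize weightedCount _ _ - _ = r at h
  refine ⟨8 * (-Real.pi * bernoulliStar (L / l i) + -Real.pi * bernoulliStar (L / l j)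
    + -Real.pi * bernoulliStar (L / l m)) - 2 * (u + v + w) - 8 * Real.pi * r, fun F δ hF => ?_⟩
  have h1 := ((((tendstoAvoiding_sawTerm hl hL i F δ hF).add
    (tendstoAvoiding_sawTerm hl hL j F δ hF)).add
    (tendstoAvoiding_sawTerm hl hL m F δ hF)).const_mul 8).sub
    ((((hu F δ hF).add (hv F δ hF)).add (hw F δ hF)).const_mul 2) |>.sub
    ((h F δ hF).const_mul (8 * Real.pi))
  refine h1.congr fun R => ?_
  have hpi := Real.pi_pos.ne'
  rw [Finset.sum_insert (by simp [hij, him]), Finset.sum_pair hjm, if_pos rfl, if_neg hji,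
    if_pos rfl, if_neg hmi, if_neg hmj]
  simp only [partialSum_const_mul, partialSum_sub, partialSum_div]
  field_simp
  ring

end partialSums

/-! ### The residue at 0 and the limit of the residue sums for the four bases -/

lemma polyPart_eq_coeff {A B C D : ℝ} (hA : A ≠ 0) (hB : B ≠ 0) (hC : C ≠ 0) (hD : D ≠ 0)
    (L : ℝ) :
    ∑ i ∈ Finset.range 5, (∑ i_1 ∈ Finset.range (i + 1), (∑ i_2 ∈ Finset.range (i_1 + 1),
      (∑ i_3 ∈ Finset.range (i_2 + 1), (L : ℂ) ^ i_3 / (i_3.factorial : ℂ)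
        * toddCoeff D (i_2 - i_3)) * toddCoeff C (i_1 - i_2))
        * toddCoeff B (i - i_1)) * toddCoeff A (4 - i) = (polyPart A B C D L : ℂ) := by
  have hA : (A : ℂ) ≠ 0 := by exact_mod_cast hA
  have hB : (B : ℂ) ≠ 0 := by exact_mod_cast hB
  have hC : (C : ℂ) ≠ 0 := by exact_mod_cast hC
  have hD : (D : ℂ) ≠ 0 := by exact_mod_cast hD
  simp only [Finset.sum_range_succ, Finset.sum_range_zero, toddCoeff, polyPart, Nat.factorial]
  push_cast
  field_simp
  ring

lemma hasTaylor_logBase (L : ℝ) : ∃ a : ℕ → ℂ,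
    a 4 = (polyPart (Real.log 2) (Real.log 3) (Real.log 5) (Real.log 7) L : ℂ) ∧
    HasTaylor (fun s => Complex.exp (s * L)
      * ∏ i ∈ ({0, 1, 2, 3} : Finset (Fin 4)), (s / (1 - Complex.exp (-(s * logBase i))))) a := by
  have hl := incommensurable_logBase
  -- Inserting 7, 5, 3, 2 in this order makes the nested Cauchy products agree with
  -- `polyPart_eq_coeff`.
  have h3 : HasTaylor _ _ := HasTaylor.insert hl (b := (3 : Fin 4)) (A := ∅) (by decide)
    (hasTaylor_empty L)
  have h2 := HasTaylor.insert hl (b := (2 : Fin 4)) (by decide) h3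
  have h1 := HasTaylor.insert hl (b := (1 : Fin 4)) (by decide) h2
  have h0 := HasTaylor.insert hl (b := (0 : Fin 4)) (by decide) h1
  refine ⟨_, ?_, h0⟩
  exact polyPart_eq_coeff (hl.pos 0).ne' (hl.pos 1).ne' (hl.pos 2).ne' (hl.pos 3).ne' L

/-- The combination of terms that a quadruple of indices contributes to the residues. -/
noncomputable def quadResidueTerm {ι : Type*} (l : ι → ℝ) (L : ℝ) (i j m n : ι) (k : ℕ) : ℝ :=
  1 / (8 * Real.pi) * (7 * sawTerm l L i k - (tripleTerm l L i j m k
    + tripleTerm l L i j n k + tripleTerm l L i m n k) / 2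
    - (pairTerm l L i j k + pairTerm l L i m k + pairTerm l L i n k)
    + quadTerm l L i j m n k)

lemma partialSum_quadResidueTerm {ι : Type*} (l : ι → ℝ) (L : ℝ) (i j m n : ι) (R : ℝ) :
    partialSum l i (quadResidueTerm l L i j m n) R
      = 1 / (8 * Real.pi) * (7 * partialSum l i (sawTerm l L i) R
        - (partialSum l i (tripleTerm l L i j m) R + partialSum l i (tripleTerm l L i j n) R
          + partialSum l i (tripleTerm l L i m n) R) / 2
        - (partialSum l i (pairTerm l L i j) R + partialSum l i (pairTerm l L i m) R
          + partialSum l i (pairTerm l L i n) R)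
        + partialSum l i (quadTerm l L i j m n) R) := by
  unfold quadResidueTerm
  simp only [partialSum_const_mul, partialSum_add, partialSum_sub, partialSum_div]

theorem tendstoAvoiding_quadResidueTerm {x : ℝ} (hx : 1 ≤ x) :
    TendstoAvoiding logBase (fun R =>
      partialSum logBase 0 (quadResidueTerm logBase (Real.log x) 0 1 2 3) R
      + (partialSum logBase 1 (quadResidueTerm logBase (Real.log x) 1 0 2 3) R
      + (partialSum logBase 2 (quadResidueTerm logBase (Real.log x) 2 0 1 3) R
      + partialSum logBase 3 (quadResidueTerm logBase (Real.log x) 3 0 1 2) R)))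
      (sevenSmoothCount x - 1 / 2 * sevenSmoothChar x
        - polyPart (Real.log 2) (Real.log 3) (Real.log 5) (Real.log 7) (Real.log x)) := by
  obtain ⟨a, ha, hT⟩ := hasTaylor_logBase (Real.log x)
  have hl := incommensurable_logBase
  have h := tendstoAvoiding_of_residues hl 0 [1, 2, 3] (by decide) (by simp)
    (A := ({0, 1, 2, 3} : Finset (Fin 4))) (by decide) (Real.log_nonneg hx) hT
    (f := ![quadResidueTerm logBase (Real.log x) 0 1 2 3,
      quadResidueTerm logBase (Real.log x) 1 0 2 3, quadResidueTerm logBase (Real.log x) 2 0 1 3,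
      quadResidueTerm logBase (Real.log x) 3 0 1 2]) (by
      intro i _ k hk
      fin_cases i
      · exact poleResidue_add_four (Real.log x) hl (i := 0) (j := 1) (m := 2) (n := 3) (by decide)
          (by decide) (by decide) (by decide) (by decide) (by decide) (by decide) hk
      · exact poleResidue_add_four (Real.log x) hl (i := 1) (j := 0) (m := 2) (n := 3) (by decide)
          (by decide) (by decide) (by decide) (by decide) (by decide) (by decide) hk
      · exact poleResidue_add_four (Real.log x) hl (i := 2) (j := 0) (m := 1) (n := 3) (by decide)
          (by decide) (by decide) (by decide) (by decide) (by decide) (by decide) hk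
      · exact poleResidue_add_four (Real.log x) hl (i := 3) (j := 0) (m := 1) (n := 2) (by decide)
          (by decide) (by decide) (by decide) (by decide) (by decide) (by decide) hk)
  have hW : weightedCount ([0, 1, 2, 3].map logBase) (Real.log x)
      = sevenSmoothCount x - 1 / 2 * sevenSmoothChar x := weightedCount_log_eq hx
  rw [hW, show ({0, 1, 2, 3} : Finset (Fin 4)).card = 4 from rfl, ha, Complex.ofReal_re] at h
  intro F δ hF
  refine (h F δ hF).congr fun R => ?_
  rw [Finset.sum_insert (by decide), Finset.sum_insert (by decide), Finset.sum_pair (by decide)]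
  rfl

lemma TendstoAvoiding.appropriateLimit {G H : ℝ → ℝ} {v : ℝ} (h : TendstoAvoiding logBase G v)
    (hGH : ∀ R, G R = H R) : AppropriateLimit H v := fun δ hδ =>
  (h _ δ (avoidsPoles_admissible hδ)).congr hGH

theorem corollary10 :
    (∃ δ : ℝ, 0 < δ ∧ (admissible δ).NeBot) ∧
    ∀ x : ℝ, 1 ≤ x →
      ∃ P₂₃ P₂₅ P₂₇ P₃₅ P₃₇ P₅₇ T₂₃₅ T₂₃₇ T₂₅₇ T₃₅₇ Q : ℝ,
        AppropriateLimit (pairSum 2 3 x) P₂₃ ∧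
        AppropriateLimit (pairSum 2 5 x) P₂₅ ∧
        AppropriateLimit (pairSum 2 7 x) P₂₇ ∧
        AppropriateLimit (pairSum 3 5 x) P₃₅ ∧
        AppropriateLimit (pairSum 3 7 x) P₃₇ ∧
        AppropriateLimit (pairSum 5 7 x) P₅₇ ∧
        AppropriateLimit
          (fun R => sineSum 2 3 5 x R + sineSum 3 2 5 x R + sineSum 5 2 3 x R) T₂₃₅ ∧
        AppropriateLimit
          (fun R => sineSum 2 3 7 x R + sineSum 3 2 7 x R + sineSum 7 2 3 x R) T₂₃₇ ∧
        AppropriateLimit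
          (fun R => sineSum 2 5 7 x R + sineSum 5 2 7 x R + sineSum 7 2 5 x R) T₂₅₇ ∧
        AppropriateLimit
          (fun R => sineSum 3 5 7 x R + sineSum 5 3 7 x R + sineSum 7 3 5 x R) T₃₅₇ ∧
        AppropriateLimit
          (fun R => cosineSum 2 3 5 7 x R + cosineSum 3 2 5 7 x R
            + cosineSum 5 2 3 7 x R + cosineSum 7 2 3 5 x R) Q ∧
        (sevenSmoothCount x : ℝ) =
          polyPart (Real.log 2) (Real.log 3) (Real.log 5) (Real.log 7) (Real.log x)
          - 7 / 8 * bernoulliStar (Real.log x / Real.log 2)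
          - 7 / 8 * bernoulliStar (Real.log x / Real.log 3)
          - 7 / 8 * bernoulliStar (Real.log x / Real.log 5)
          - 7 / 8 * bernoulliStar (Real.log x / Real.log 7)
          - 1 / (8 * Real.pi) * P₂₃ - 1 / (8 * Real.pi) * P₂₅ - 1 / (8 * Real.pi) * P₂₇
          - 1 / (8 * Real.pi) * P₃₅ - 1 / (8 * Real.pi) * P₃₇ - 1 / (8 * Real.pi) * P₅₇
          - 1 / (16 * Real.pi) * T₂₃₅ - 1 / (16 * Real.pi) * T₂₃₇
          - 1 / (16 * Real.pi) * T₂₅₇ - 1 / (16 * Real.pi) * T₃₅₇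
          + 1 / (8 * Real.pi) * Q
          + 1 / 2 * sevenSmoothChar x := by
  refine ⟨admissible_neBot, fun x hx => ?_⟩
  have hl := incommensurable_logBase
  have hL := Real.log_nonneg hx
  obtain ⟨P01, h01⟩ := exists_tendstoAvoiding_pairTerm hl hL (by decide : (0 : Fin 4) ≠ 1)
  obtain ⟨P02, h02⟩ := exists_tendstoAvoiding_pairTerm hl hL (by decide : (0 : Fin 4) ≠ 2)
  obtain ⟨P03, h03⟩ := exists_tendstoAvoiding_pairTerm hl hL (by decide : (0 : Fin 4) ≠ 3)
  obtain ⟨P12, h12⟩ := exists_tendstoAvoiding_pairTerm hl hL (by decide : (1 : Fin 4) ≠ 2)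
  obtain ⟨P13, h13⟩ := exists_tendstoAvoiding_pairTerm hl hL (by decide : (1 : Fin 4) ≠ 3)
  obtain ⟨P23, h23⟩ := exists_tendstoAvoiding_pairTerm hl hL (by decide : (2 : Fin 4) ≠ 3)
  obtain ⟨T012, h012⟩ := exists_tendstoAvoiding_tripleTerm hl hL (by decide : (0 : Fin 4) ≠ 1)
    (by decide : (0 : Fin 4) ≠ 2) (by decide)
  obtain ⟨T013, h013⟩ := exists_tendstoAvoiding_tripleTerm hl hL (by decide : (0 : Fin 4) ≠ 1)
    (by decide : (0 : Fin 4) ≠ 3) (by decide)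
  obtain ⟨T023, h023⟩ := exists_tendstoAvoiding_tripleTerm hl hL (by decide : (0 : Fin 4) ≠ 2)
    (by decide : (0 : Fin 4) ≠ 3) (by decide)
  obtain ⟨T123, h123⟩ := exists_tendstoAvoiding_tripleTerm hl hL (by decide : (1 : Fin 4) ≠ 2)
    (by decide : (1 : Fin 4) ≠ 3) (by decide)
  have hS := tendstoAvoiding_sawTerm hl hL
  have hres := tendstoAvoiding_quadResidueTerm hx
  have hpi := Real.pi_pos.ne'
  set W := (sevenSmoothCount x : ℝ) - 1 / 2 * sevenSmoothChar x
    - polyPart (Real.log 2) (Real.log 3) (Real.log 5) (Real.log 7) (Real.log x) with hW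
  -- The four-base limit is solved for the quadruple sums, all other sums being known to converge.
  -- The limit obtained is exactly the value of Q that makes the formula true.
  have hQ : TendstoAvoiding logBase (fun R =>
      partialSum logBase 0 (quadTerm logBase (Real.log x) 0 1 2 3) R
      + partialSum logBase 1 (quadTerm logBase (Real.log x) 1 0 2 3) R
      + partialSum logBase 2 (quadTerm logBase (Real.log x) 2 0 1 3) R
      + partialSum logBase 3 (quadTerm logBase (Real.log x) 3 0 1 2) R)
      (8 * Real.pi * W
        - 7 * (-Real.pi * bernoulliStar (Real.log x / Real.log 2)
          + -Real.pi * bernoulliStar (Real.log x / Real.log 3)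
          + -Real.pi * bernoulliStar (Real.log x / Real.log 5)
          + -Real.pi * bernoulliStar (Real.log x / Real.log 7))
        + (T012 + T013 + T023 + T123) / 2 + (P01 + P02 + P03 + P12 + P13 + P23)) := by
    intro F δ hF
    refine (((((hres F δ hF).const_mul (8 * Real.pi)).sub
      (((((hS 0 F δ hF).add (hS 1 F δ hF)).add (hS 2 F δ hF)).add (hS 3 F δ hF)).const_mul 7)).add
      (((((h012 F δ hF).add (h013 F δ hF)).add (h023 F δ hF)).add (h123 F δ hF)).div_const 2)).add
      ((((((h01 F δ hF).add (h02 F δ hF)).add (h03 F δ hF)).add (h12 F δ hF)).add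
        (h13 F δ hF)).add (h23 F δ hF))).congr fun R => ?_
    simp only [partialSum_quadResidueTerm]
    field_simp
    ring
  -- Each `rfl` unfolds `partialSum` and evaluates `logBase` at a numeral.
  refine ⟨P01, P02, P03, P12, P13, P23, T012, T013, T023, T123, _,
    h01.appropriateLimit fun R => rfl, h02.appropriateLimit fun R => rfl,
    h03.appropriateLimit fun R => rfl, h12.appropriateLimit fun R => rfl,
    h13.appropriateLimit fun R => rfl, h23.appropriateLimit fun R => rfl,
    h012.appropriateLimit fun R => rfl, h013.appropriateLimit fun R => rfl,
    h023.appropriateLimit fun R => rfl, h123.appropriateLimit fun R => rfl,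
    hQ.appropriateLimit fun R => rfl, ?_⟩
  rw [hW]
  field_simp
  ring
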